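/- \textbf{Setting.} $n$ bidders have private values drawn independently from an atomless distribution $F$ (with continuous CDF, also denoted $F$) whose support is $[0,\bar v]$. A bidder with value $v$ who receives the fraction $x$ of a unit of a divisible good and pays $p\ge 0$ has utility $v x-c(p)$, where the payment function $c:[0,\infty)\to[0,\infty)$ is common to all bidders. Bidders evaluate allocations and payments in expectation over the values of the others. \textbf{The auction.} Each bidder $i$ submits a bid $b_i\ge 0$. Every bidder whose bid is among the top $n/4$ bids (that is, of rank at most $\lfloor n/4\rfloor$) receives $4/n$ of the good, and all other bidders receive nothing; bids that tie for the last winning places share these places equally. Every bidder pays his bid $b_i$, whether or not he receives anything. The auction depends neither on $F$ nor on $c$. \textbf{(a) Equilibrium.} Let $c$ be a strictly increasing bijection of $[0,\infty)$ onto itself (for instance a strictly increasing convex function with $c(0)=0$). A (pure-strategy) Bayes--Nash equilibrium is a profile of measurable bid functions $s_i:[0,\bar v]\to[0,\infty)$ such that for every $i$ and every value $v\in[0,\bar v]$ the bid $s_i(v)$ maximizes the expected utility of bidder $i$ over all bids $b\ge0$, given the strategies of the others. The auction has exactly one Bayes--Nash equilibrium (among all profiles, symmetric or not), namely $$ b_i(v)=c^{-1}\Bigl(v\,\hat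 x_i(v)-\int_0^{v}\hat x_i(z)\,dz\Bigr),\qquad v\in[0,\bar v],$$ where $$\hat x_i(v)=\frac4n\,\Pr\Bigl(\sum_{j\ne i}\mathbf 1_{v_j\ge v}\le \frac n4-1\Bigr).$$ \textbf{(b) Revenue.} Assume moreover that $c(p)=p^d$ for a real $d\ge2$, that $F$ has a continuous density $f$ that is strictly positive on $[0,\bar v]$ with monotone hazard rate, i.e. $f(v)/(1-F(v))$ is nondecreasing on $[0,\bar v)$, and that $$n\ge 32\log(16\,\bar v/\kappa),$$ where $\kappa$ is the median, $F(\kappa)=1/2$. Let $APX$ be the expected total payment at the unique Bayes--Nash equilibrium of the auction. Let $OPT$ be the supremum of the expected total payment $\mathbb E\bigl[\sum_i p_i(v_1,\dots,v_n)\bigr]$ under truthful reports over all direct mechanisms $(x,p)$ with measurable $x:[0,\bar v]^n\to[0,1]^n$ and $p:[0,\bar v]^n\to[0,\infty)^n$ that are ex-post feasible ($\sum_i x_i\le1$ always), Bayesian incentive compatible and interim individually rational; the last two mean that, with $\hat x_i(v)=\mathbb E_{v_{-i}}[x_i(v,v_{-i})]$ and $\hat c_i(v)=\mathbb E_{v_{-i}}[c(p_i(v,v_{-i}))]<\infty$,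 for all $i$ and $v,w\in[0,\bar v]$ one has $v\hat x_i(v)-\hat c_i(v)\ge v\hat x_i(w)-\hat c_i(w)$ and $v\hat x_i(v)-\hat c_i(v)\ge0$. Then $0<OPT<\infty$ and $$\frac{APX}{OPT}\ge\frac1{16}.$$ -/

import Mathlib

open MeasureTheory ProbabilityTheory Set

open scoped ENNReal

noncomputable section

/-- A mechanism for one divisible good and `n` bidders: it maps the profile of bids (or of reported
values, for a direct mechanism) to the allocation and to the payment of every bidder. -/
structure Mechanism (n : ℕ) where
  alloc : (Fin n → ℝ) → Fin n → ℝ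
  pay : (Fin n → ℝ) → Fin n → ℝ

/-- The law of the profile of values: independent draws from `F`. -/
def valueLaw (n : ℕ) (F : Measure ℝ) : Measure (Fin n → ℝ) :=
  Measure.pi fun _ => F

/-- The profile of bids when bidder `i` bids `b`, every other bidder `j` uses the strategy `s j`,
and the values are `w`. -/
def bidsAgainst {n : ℕ} (s : Fin n → ℝ → ℝ) (i : Fin n) (b : ℝ) (w : Fin n → ℝ) : Fin n → ℝ :=
  Function.update (fun j => s j (w j)) i b

/-- Interim allocation of bidder `i` when he bids `b` and the others play `s`. -/
def interimAlloc {n : ℕ} (F : Measure ℝ) (M : Mechanism n) (s : Fin n → ℝ → ℝ)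
    (i : Fin n) (b : ℝ) : ℝ :=
  ∫ w, M.alloc (bidsAgainst s i b w) i ∂(valueLaw n F)

/-- Interim perceived payment of bidder `i` when he bids `b` and the others play `s`; `c` is the
payment function common to all bidders. -/
def interimCost {n : ℕ} (F : Measure ℝ) (c : ℝ → ℝ) (M : Mechanism n) (s : Fin n → ℝ → ℝ)
    (i : Fin n) (b : ℝ) : ℝ :=
  ∫ w, c (M.pay (bidsAgainst s i b w) i) ∂(valueLaw n F)

/-- Interim utility of bidder `i` with value `v` when he bids `b` and the others play `s`. -/
def interimUtility {n : ℕ} (F : Measure ℝ) (c : ℝ → ℝ) (M : Mechanism n) (s : Fin n → ℝ → ℝ)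
    (i : Fin n) (v b : ℝ) : ℝ :=
  v * interimAlloc F M s i b - interimCost F c M s i b

/-- Expected revenue when the bidders play `s`, as an extended nonnegative real. -/
def revenue {n : ℕ} (F : Measure ℝ) (M : Mechanism n) (s : Fin n → ℝ → ℝ) : ℝ≥0∞ :=
  ∫⁻ w, ∑ i, ENNReal.ofReal (M.pay (fun j => s j (w j)) i) ∂(valueLaw n F)

/-- `s` is a (pure, not necessarily symmetric) Bayes-Nash equilibrium of `M`, where values lie in
`[0, vbar]` and bids in `[0, ∞)`. Only the restriction of `s i` to `[0, vbar]` matters. -/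
structure IsBayesNash {n : ℕ} (F : Measure ℝ) (vbar : ℝ) (c : ℝ → ℝ) (M : Mechanism n)
    (s : Fin n → ℝ → ℝ) : Prop where
  measurable : ∀ i, Measurable (s i)
  nonneg : ∀ i, ∀ v ∈ Icc 0 vbar, 0 ≤ s i v
  best_response : ∀ i, ∀ v ∈ Icc 0 vbar, ∀ b, 0 ≤ b →
    interimUtility F c M s i v b ≤ interimUtility F c M s i v (s i v)

/-- The truthful strategies in a direct mechanism. -/
def truthful (n : ℕ) : Fin n → ℝ → ℝ := fun _ v => v

/-- The direct mechanisms among which the auctioneer optimizes: ex-post feasible (`XP`), Bayesian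
incentive compatible (`BIC`) and interim individually rational (`IIR`). -/
structure IsAdmissible {n : ℕ} (F : Measure ℝ) (vbar : ℝ) (c : ℝ → ℝ) (M : Mechanism n) :
    Prop where
  measurable_alloc : ∀ i, Measurable fun v => M.alloc v i
  measurable_pay : ∀ i, Measurable fun v => M.pay v i
  alloc_mem : ∀ v : Fin n → ℝ, (∀ j, v j ∈ Icc 0 vbar) → ∀ i, M.alloc v i ∈ Icc (0 : ℝ) 1
  pay_nonneg : ∀ v : Fin n → ℝ, (∀ j, v j ∈ Icc 0 vbar) → ∀ i, 0 ≤ M.pay v i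
  xp : ∀ v : Fin n → ℝ, (∀ j, v j ∈ Icc 0 vbar) → ∑ i, M.alloc v i ≤ 1
  /-- The interim perceived payments are finite. -/
  integrable_cost : ∀ i, ∀ v ∈ Icc 0 vbar,
    Integrable (fun w => c (M.pay (bidsAgainst (truthful n) i v w) i)) (valueLaw n F)
  bic : ∀ i, ∀ v ∈ Icc 0 vbar, ∀ v' ∈ Icc 0 vbar,
    interimUtility F c M (truthful n) i v v' ≤ interimUtility F c M (truthful n) i v v
  iir : ∀ i, ∀ v ∈ Icc 0 vbar, 0 ≤ interimUtility F c M (truthful n) i v v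

/-- `OPT`: the supremum of the expected revenue over all admissible mechanisms. -/
def optRevenue (n : ℕ) (F : Measure ℝ) (vbar : ℝ) (c : ℝ → ℝ) : ℝ≥0∞ :=
  ⨆ (M : Mechanism n) (_ : IsAdmissible F vbar c M), revenue F M (truthful n)

/-- The all-pay auction that gives `4 / n` to each of the `⌊n / 4⌋` highest bids and charges every
bidder his bid. Bids that tie for the last winning places share these places equally: with `A` bids
above `b i` and `T` bids equal to `b i`, each of the latter gets the fraction
`min 1 ((⌊n / 4⌋ - A) / T)` (or `0` if `A ≥ ⌊n / 4⌋`) of `4 / n`. -/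
def topQuarterAllPay (n : ℕ) : Mechanism n where
  alloc b i := 4 / (n : ℝ) *
    max 0 (min 1 ((((n / 4 : ℕ) : ℝ) - ({j | b i < b j} : Set (Fin n)).ncard) /
      ({j | b j = b i} : Set (Fin n)).ncard))
  pay b i := b i

/-- The interim allocation of bidder `i` with value `v` when `4 / n` is awarded to each bidder whose
value is among the `n / 4` highest ones. -/
def rankInterimAlloc {n : ℕ} (F : Measure ℝ) (i : Fin n) (v : ℝ) : ℝ :=
  4 / (n : ℝ) * (valueLaw n F).real
    {w | (({j | j ≠ i ∧ v ≤ w j} : Set (Fin n)).ncard : ℝ) ≤ (n : ℝ) / 4 - 1}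

/-- The bid `c⁻¹ (v x̂(v) - ∫₀ᵛ x̂)`, with the inverse of `c` on `[0, ∞)`. -/
def equilibriumBid {n : ℕ} (F : Measure ℝ) (c : ℝ → ℝ) (i : Fin n) (v : ℝ) : ℝ :=
  Function.invFunOn c (Ici 0)
    (v * rankInterimAlloc F i v - ∫ z in (0 : ℝ)..v, rankInterimAlloc F i z)

/-- `F` has a continuous density `f` that is positive on the support `[0, vbar]`, and its hazard
rate `f / (1 - F)` is nondecreasing. -/
def IsMHR (F : Measure ℝ) (vbar : ℝ) : Prop :=
  ∃ f : ℝ → ℝ, ContinuousOn f (Icc 0 vbar) ∧ (∀ v ∈ Icc 0 vbar, 0 < f v) ∧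
    F = (volume.restrict (Icc 0 vbar)).withDensity (fun v => ENNReal.ofReal (f v)) ∧
    MonotoneOn (fun v => f v / (1 - cdf F v)) (Ico 0 vbar)

end

/-! Uniqueness. Measure bids by their cost, t = c ∘ s. Since slightly overbidding breaks all ties,
each bidder replies optimally to the tie-free winning curve X of `spendingAlloc`, so t is monotone.
For a value v the indifference line through (t v, X (t v)) has slope 1/v and lies above X; the lower
envelope of these lines touches X at the bids used, and its slope at y is roughly one over the value
that bids y. Suppose two bidders have different thresholds. On the stretch where values of bidder 1
bid lower, the envelope of bidder 2 rises strictly faster. Yet the difference of the envelopes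
starts nonnegative and ends nonpositive, because the lower bidder faces the more aggressive rival
(`IsBestReply.bidThreshold_le_bidThreshold`). So equilibria are symmetric. A flat piece would then
be a common tie of positive probability, which is strictly harmful; hence bids are strictly
increasing, allocations are the rank allocations x̂, and the envelope formula gives the cost.
Existence is the usual single-crossing argument.

Revenue. Let κ be the median. A monotone hazard rate gives mean at most 2κ. Jensen and individual
rationality bound the interim payment by (v x̂(v))^(1/d). The AM-GM inequality makes this linear in
v and x̂, so feasibility gives OPT ≤ n (2κ/n)^(1/d). In the auction, values above the 7/8 quantile a
have cost at least κ (x̂(a) - x̂(κ)) ≥ κ/(2n), by Markov at a and Chernoff at κ. Thus APX ≥ (n/8)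
(κ/(2n))^(1/d), and 4^(1/d) ≤ 2 yields the factor 1/16. -/

/-! ### Best replies and envelopes of indifference lines. -/

/-- The values in `[0, vbar]` bid optimally, in units of utility, when a bid `y` wins `X y`. -/
def IsBestReply (X t : ℝ → ℝ) (vbar : ℝ) : Prop :=
  ∀ v ∈ Icc 0 vbar, 0 ≤ t v ∧ ∀ y, 0 ≤ y → v * X y - y ≤ v * X (t v) - t v

/-- The lower envelope of the indifference lines of the values in `[a, vbar]`. -/
noncomputable def linearEnvelope (X t : ℝ → ℝ) (a vbar y : ℝ) : ℝ :=
  ⨅ v : Icc a vbar, (X (t v) + (y - t v) / v)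

/-- The largest value in `[0, vbar]` that bids at most `y`. -/
noncomputable def bidThreshold (t : ℝ → ℝ) (vbar y : ℝ) : ℝ :=
  sSup {v | v ∈ Icc 0 vbar ∧ t v ≤ y}

namespace IsBestReply

variable {X t : ℝ → ℝ} {vbar a : ℝ}

/-- Revealed preference: nothing on the curve X lies above the indifference line of v, whose slope
is 1/v. -/
lemma slope_bound (h : IsBestReply X t vbar) {v y : ℝ} (hv : v ∈ Icc 0 vbar) (hv0 : 0 < v)
    (hy : 0 ≤ y) : X y ≤ X (t v) + (y - t v) / v := by
  have := (h v hv).2 y hy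
  rw [← sub_le_iff_le_add', le_div_iff₀ hv0]
  linarith

lemma zero (h : IsBestReply X t vbar) (hvb : 0 ≤ vbar) : t 0 = 0 := by
  have h0 := h 0 ⟨le_rfl, hvb⟩
  have := h0.2 0 le_rfl
  linarith [h0.1]

/-- Adding the two revealed-preference inequalities shows that the higher value wins at least as
much. If he bid less, monotonicity of X would make the two winnings equal, and v would pay more for
nothing. -/
lemma monotoneOn (h : IsBestReply X t vbar) (hX : MonotoneOn X (Ici 0)) :
    MonotoneOn t (Icc 0 vbar) := by
  intro v hv w hw hvw
  rcases hvw.eq_or_lt with rfl | hlt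
  · exact le_rfl
  have h1 := (h v hv).2 (t w) (h w hw).1
  have h2 := (h w hw).2 (t v) (h v hv).1
  by_contra! hc
  have h3 := hX (h w hw).1 (h v hv).1 hc.le
  have h4 : X (t v) ≤ X (t w) := by
    by_contra! h5
    nlinarith
  have h6 : X (t w) = X (t v) := le_antisymm h3 h4
  rw [h6] at h1
  linarith

variable (h : IsBestReply X t vbar) (ha : 0 < a) (hav : a ≤ vbar)
include h ha

lemma bddBelow_envelope {y : ℝ} (hy : 0 ≤ y) :
    BddBelow (range fun v : Icc a vbar => X (t v) + (y - t v) / v) := by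
  refine ⟨X y, ?_⟩
  rintro _ ⟨v, rfl⟩
  exact h.slope_bound ⟨ha.le.trans v.2.1, v.2.2⟩ (ha.trans_le v.2.1) hy

lemma envelope_le {y v : ℝ} (hy : 0 ≤ y) (hv : v ∈ Icc a vbar) :
    linearEnvelope X t a vbar y ≤ X (t v) + (y - t v) / v :=
  ciInf_le (h.bddBelow_envelope ha hy) (⟨v, hv⟩ : Icc a vbar)

include hav

lemma le_envelope {y : ℝ} (hy : 0 ≤ y) : X y ≤ linearEnvelope X t a vbar y := by
  have : Nonempty (Icc a vbar) := ⟨⟨a, le_rfl, hav⟩⟩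
  exact le_ciInf fun v =>
    h.slope_bound ⟨ha.le.trans v.2.1, v.2.2⟩ (ha.trans_le v.2.1) hy

omit hav in
lemma envelope_bid {v : ℝ} (hv : v ∈ Icc a vbar) : linearEnvelope X t a vbar (t v) = X (t v) := by
  have h0 : 0 ≤ t v := (h v ⟨ha.le.trans hv.1, hv.2⟩).1
  refine le_antisymm ?_ (h.le_envelope ha (hv.1.trans hv.2) h0)
  simpa using h.envelope_le ha h0 hv

lemma envelope_mono {y y' : ℝ} (hy : 0 ≤ y) (hyy : y ≤ y') :
    linearEnvelope X t a vbar y ≤ linearEnvelope X t a vbar y' := by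
  have : Nonempty (Icc a vbar) := ⟨⟨a, le_rfl, hav⟩⟩
  refine le_ciInf fun v => (h.envelope_le ha hy v.2).trans ?_
  have : (0 : ℝ) < v := ha.trans_le v.2.1
  gcongr

/-- Right of t v the slope is at most 1/v: lines of larger values are flatter, and a line of a
smaller value already lies above the line of v there. -/
lemma envelope_le_add {y y' v : ℝ} (hy : 0 ≤ y) (hyy : y ≤ y') (hv : v ∈ Icc a vbar)
    (htv : t v ≤ y) :
    linearEnvelope X t a vbar y' ≤ linearEnvelope X t a vbar y + (y' - y) / v := by
  have : Nonempty (Icc a vbar) := ⟨⟨a, le_rfl, hav⟩⟩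
  rw [← sub_le_iff_le_add]
  refine le_ciInf fun w => ?_
  have hw0 : (0 : ℝ) < w := ha.trans_le w.2.1
  have hv0 : (0 : ℝ) < v := ha.trans_le hv.1
  have htv0 : 0 ≤ t v := (h v ⟨hv0.le, hv.2⟩).1
  rw [sub_le_iff_le_add]
  rcases le_total v (w : ℝ) with hvw | hwv
  · refine (h.envelope_le ha (hy.trans hyy) w.2).trans ?_
    have : (y' - y) / (w : ℝ) ≤ (y' - y) / v := by
      apply div_le_div_of_nonneg_left _ hv0 hvw; linarith
    have e : (y' - t w) / (w : ℝ) = (y - t w) / w + (y' - y) / w := by ring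
    linarith
  · refine (h.envelope_le ha (hy.trans hyy) hv).trans ?_
    have h1 := h.slope_bound (v := w) ⟨hw0.le, w.2.2⟩ hw0 htv0
    have h2 : (y - t v) / v ≤ (y - t v) / (w : ℝ) := by
      apply div_le_div_of_nonneg_left _ hw0 hwv; linarith
    have e : (y' - t v) / v = (y - t v) / v + (y' - y) / v := by ring
    have e2 : (y - t w) / (w : ℝ) = (y - t v) / w + (t v - t w) / w := by ring
    linarith

/-- The mirror image: left of t v the lines of larger values lie above that of v, and those of
smaller values are steeper. -/
lemma add_le_envelope {y y' v : ℝ} (hy : 0 ≤ y) (hyy : y ≤ y') (hv : v ∈ Icc a vbar)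
    (htv : y' ≤ t v) :
    linearEnvelope X t a vbar y + (y' - y) / v ≤ linearEnvelope X t a vbar y' := by
  have : Nonempty (Icc a vbar) := ⟨⟨a, le_rfl, hav⟩⟩
  refine le_ciInf fun w => ?_
  have hw0 : (0 : ℝ) < w := ha.trans_le w.2.1
  have hv0 : (0 : ℝ) < v := ha.trans_le hv.1
  rcases le_total (w : ℝ) v with hvw | hwv
  · have h1 := h.envelope_le ha hy w.2
    have : (y' - y) / v ≤ (y' - y) / (w : ℝ) := by
      apply div_le_div_of_nonneg_left _ hw0 hvw; linarith
    have e : (y' - t w) / (w : ℝ) = (y - t w) / w + (y' - y) / w := by ring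
    linarith
  · have h0 := h.envelope_le ha hy hv
    have h1 := h.slope_bound (v := w) ⟨hw0.le, w.2.2⟩ hw0 ((hy.trans hyy).trans htv)
    have h2 : (t v - y') / (w : ℝ) ≤ (t v - y') / v := by
      apply div_le_div_of_nonneg_left _ hv0 hwv; linarith
    have e : (y - t v) / v = - ((t v - y') / v) - (y' - y) / v := by ring
    have e2 : (t v - t w) / (w : ℝ) = (y' - t w) / w + (t v - y') / w := by ring
    linarith

lemma envelope_le_add_self {y y' : ℝ} (hy : 0 ≤ y) (hyy : y ≤ y') :
    linearEnvelope X t a vbar y' ≤ linearEnvelope X t a vbar y + (y' - y) / a := by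
  have : Nonempty (Icc a vbar) := ⟨⟨a, le_rfl, hav⟩⟩
  rw [← sub_le_iff_le_add]
  refine le_ciInf fun w => ?_
  rw [sub_le_iff_le_add]
  refine (h.envelope_le ha (hy.trans hyy) w.2).trans ?_
  have : (y' - y) / (w : ℝ) ≤ (y' - y) / a := by
    apply div_le_div_of_nonneg_left _ ha w.2.1; linarith
  have e : (y' - t w) / (w : ℝ) = (y - t w) / w + (y' - y) / w := by ring
  linarith

/-- All slopes are at most 1/a, so the envelope is Lipschitz; this is why values below a > 0 are
left out. -/
lemma continuousOn_envelope : ContinuousOn (linearEnvelope X t a vbar) (Ici 0) := by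
  have key : ∀ y ∈ Ici (0 : ℝ), ∀ z ∈ Ici (0 : ℝ), y ≤ z →
      dist (linearEnvelope X t a vbar y) (linearEnvelope X t a vbar z) ≤ a⁻¹ * dist y z := by
    intro y hy z hz hyz
    have h1 := h.envelope_mono ha hav hy hyz
    have h2 := h.envelope_le_add_self ha hav hy hyz
    rw [Real.dist_eq, Real.dist_eq, abs_sub_comm, abs_sub_comm y, abs_of_nonneg (by linarith),
      abs_of_nonneg (by linarith)]
    rw [div_eq_inv_mul] at h2
    linarith
  refine (LipschitzOnWith.of_dist_le_mul (K := ⟨a⁻¹, by positivity⟩) ?_).continuousOn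
  intro y hy z hz
  rcases le_total y z with hyz | hyz
  · exact key y hy z hz hyz
  · rw [dist_comm, dist_comm y]; exact key z hz y hy hyz

end IsBestReply

/-! ### Thresholds as generalized inverses of bid functions. -/

section Threshold

variable {t : ℝ → ℝ} {vbar : ℝ}

lemma bddAbove_bidThreshold (t : ℝ → ℝ) (vbar y : ℝ) :
    BddAbove {v | v ∈ Icc 0 vbar ∧ t v ≤ y} := ⟨vbar, fun _ hv => hv.1.2⟩

lemma le_bidThreshold {v y : ℝ} (hv : v ∈ Icc 0 vbar) (h : t v ≤ y) : v ≤ bidThreshold t vbar y :=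
  le_csSup (bddAbove_bidThreshold t vbar y) ⟨hv, h⟩

lemma lt_of_bidThreshold_lt {v y : ℝ} (hv : v ∈ Icc 0 vbar) (h : bidThreshold t vbar y < v) :
    y < t v := by
  by_contra! hc
  exact absurd (le_bidThreshold hv hc) h.not_ge

lemma bidThreshold_nonneg (t : ℝ → ℝ) (vbar y : ℝ) : 0 ≤ bidThreshold t vbar y :=
  Real.sSup_nonneg fun _ hv => hv.1.1

lemma bidThreshold_le (hvb : 0 ≤ vbar) (y : ℝ) : bidThreshold t vbar y ≤ vbar :=
  Real.sSup_le (fun _ hv => hv.1.2) hvb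

lemma le_of_lt_bidThreshold (ht : MonotoneOn t (Icc 0 vbar)) {v y : ℝ} (hv : v ∈ Icc 0 vbar)
    (h : v < bidThreshold t vbar y) : t v ≤ y := by
  have hne : {v | v ∈ Icc 0 vbar ∧ t v ≤ y}.Nonempty := by
    by_contra hc
    rw [not_nonempty_iff_eq_empty] at hc
    -- The default `sSup ∅ = 0` is harmless, as v ≥ 0.
    rw [bidThreshold, hc, Real.sSup_empty] at h
    exact absurd hv.1 h.not_ge
  obtain ⟨w, hw, hvw⟩ := exists_lt_of_lt_csSup hne h
  exact (ht hv hw.1 hvw.le).trans hw.2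

lemma bidThreshold_mono {y z : ℝ} (hyz : y ≤ z) :
    bidThreshold t vbar y ≤ bidThreshold t vbar z :=
  Real.sSup_le (fun _ hv => le_bidThreshold hv.1 (hv.2.trans hyz)) (bidThreshold_nonneg _ _ _)

end Threshold

/-! ### Symmetry of equilibria, and the envelope formula. -/

/-- If two bidders reply optimally and the more aggressive one, at every bid, faces the weaker
competition, then neither is more aggressive. -/
lemma IsBestReply.bidThreshold_le_bidThreshold {X₁ X₂ t₁ t₂ : ℝ → ℝ} {vbar : ℝ} (hvb : 0 < vbar)
    (h₁ : IsBestReply X₁ t₁ vbar) (h₂ : IsBestReply X₂ t₂ vbar)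
    (hX₁ : MonotoneOn X₁ (Ici 0)) (hX₂ : MonotoneOn X₂ (Ici 0))
    (h₁₂ : ∀ y, 0 ≤ y → bidThreshold t₂ vbar y ≤ bidThreshold t₁ vbar y → X₁ y ≤ X₂ y)
    (h₂₁ : ∀ y, 0 ≤ y → bidThreshold t₁ vbar y ≤ bidThreshold t₂ vbar y → X₂ y ≤ X₁ y)
    (y₀ : ℝ) : bidThreshold t₁ vbar y₀ ≤ bidThreshold t₂ vbar y₀ := by
  by_contra! hlt
  have ht₁ := h₁.monotoneOn hX₁
  have ht₂ := h₂.monotoneOn hX₂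
  obtain ⟨v₀, hv₀2, hv₀1⟩ := exists_between hlt
  have hv₀ : 0 < v₀ := (bidThreshold_nonneg _ _ _).trans_lt hv₀2
  have hv₀b : v₀ ≤ vbar := hv₀1.le.trans (bidThreshold_le hvb.le _)
  have hv₀I : v₀ ∈ Icc 0 vbar := ⟨hv₀.le, hv₀b⟩
  set lo := t₁ v₀ with hlo
  have hlo0 : 0 ≤ lo := (h₁ v₀ hv₀I).1
  have hloy : lo ≤ y₀ := le_of_lt_bidThreshold ht₁ hv₀I hv₀1
  have hlo1 : ∀ y, lo ≤ y → v₀ ≤ bidThreshold t₁ vbar y := fun y hy => le_bidThreshold hv₀I hy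
  -- The infimum `hi` of `S` ends the stretch starting at `lo` on which the threshold of bidder 1 is
  -- strictly the larger one.
  set S := {y | lo ≤ y ∧ bidThreshold t₁ vbar y ≤ bidThreshold t₂ vbar y} with hS
  have hvI : vbar ∈ Icc 0 vbar := ⟨hvb.le, le_rfl⟩
  have hSne : S.Nonempty := by
    refine ⟨max lo (t₂ vbar), le_max_left _ _, (bidThreshold_le hvb.le _).trans ?_⟩
    exact le_bidThreshold hvI (le_max_right _ _)
  have hSb : BddBelow S := ⟨lo, fun y hy => hy.1⟩
  set hi := sInf S with hhi
  have hlohi' : lo ≤ hi := le_csInf hSne fun y hy => hy.1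
  have hin : ∀ y, lo ≤ y → y < hi → bidThreshold t₂ vbar y < bidThreshold t₁ vbar y := by
    intro y hy hyh
    by_contra! hc
    exact notMem_of_lt_csInf hyh hSb ⟨hy, hc⟩
  -- The infimum is attained: a value v strictly between the thresholds would have t₂ v > hi, so
  -- some y in S below t₂ v would violate the inequality defining S.
  have hhi1 : bidThreshold t₁ vbar hi ≤ bidThreshold t₂ vbar hi := by
    by_contra! hc
    obtain ⟨v, hv2, hv1⟩ := exists_between hc
    have hvI : v ∈ Icc 0 vbar :=
      ⟨(bidThreshold_nonneg _ _ _).trans hv2.le, hv1.le.trans (bidThreshold_le hvb.le _)⟩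
    have htv := lt_of_bidThreshold_lt hvI hv2
    obtain ⟨y, hyS, hy⟩ := exists_lt_of_csInf_lt hSne htv
    have e1 : bidThreshold t₁ vbar hi ≤ bidThreshold t₁ vbar y :=
      bidThreshold_mono (csInf_le hSb hyS)
    have e2 : bidThreshold t₂ vbar y ≤ v := by
      by_contra! hc2
      exact absurd (le_of_lt_bidThreshold ht₂ hvI hc2) hy.not_ge
    linarith [hyS.2]
  have hlohi : lo < hi := by
    refine lt_of_le_of_ne hlohi' fun he => ?_
    have : bidThreshold t₂ vbar lo < v₀ :=
      (bidThreshold_mono hloy).trans_lt hv₀2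
    have := hlo1 lo le_rfl
    rw [← he] at hhi1
    linarith
  -- Any a strictly between 0 and v₀ would do.
  set a := v₀ / 2 with ha_def
  have ha : 0 < a := by positivity
  have hav₀ : a < v₀ := by rw [ha_def]; linarith
  have hav : a ≤ vbar := hav₀.le.trans hv₀b
  set W := fun y => linearEnvelope X₂ t₂ a vbar y - linearEnvelope X₁ t₁ a vbar y with hW
  have hWlo : 0 ≤ W lo := by
    have e1 : linearEnvelope X₁ t₁ a vbar lo = X₁ lo := h₁.envelope_bid ha ⟨hav₀.le, hv₀b⟩
    have e2 := h₂.le_envelope ha hav hlo0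
    have e3 := h₁₂ lo hlo0 (hin lo le_rfl hlohi).le
    simp only [hW]
    linarith
  -- Choose v₁ < v₂ between the two thresholds at y: just right of y the second envelope has slope
  -- at least 1/v₁, the first at most 1/v₂.
  have hstep : ∀ y, lo ≤ y → y < hi → ∃ z ∈ Icc lo hi, W y < W z := by
    intro y hy hyh
    have hlt : max (bidThreshold t₂ vbar y) a < bidThreshold t₁ vbar y :=
      max_lt (hin y hy hyh) (hav₀.trans_le (hlo1 y hy))
    obtain ⟨v₁, hv₁, hv₁'⟩ := exists_between hlt
    obtain ⟨v₂, hv₂, hv₂'⟩ := exists_between hv₁'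
    have hv₂b : v₂ ≤ vbar := hv₂'.le.trans (bidThreshold_le hvb.le _)
    have hv₁a : a < v₁ := (le_max_right _ _).trans_lt hv₁
    have hy0 : 0 ≤ y := hlo0.trans hy
    have hyt2 : y < t₂ v₁ := lt_of_bidThreshold_lt ⟨by linarith, by linarith⟩
      ((le_max_left _ _).trans_lt hv₁)
    have hty1 : t₁ v₂ ≤ y := le_of_lt_bidThreshold ht₁ ⟨by linarith, by linarith⟩ hv₂'
    set z := min (t₂ v₁) hi with hz
    have hyz : y < z := lt_min hyt2 hyh
    refine ⟨z, ⟨hy.trans hyz.le, min_le_right _ _⟩, ?_⟩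
    have e1 := h₁.envelope_le_add ha hav hy0 hyz.le (v := v₂) ⟨by linarith, hv₂b⟩ hty1
    have e2 := h₂.add_le_envelope ha hav hy0 hyz.le (v := v₁) ⟨by linarith, by linarith⟩
      (min_le_left _ _)
    have e3 : (z - y) / v₂ < (z - y) / v₁ :=
      div_lt_div_of_pos_left (by linarith) (by linarith) hv₂
    simp only [hW]
    linarith
  have hWc : ContinuousOn W (Icc lo hi) :=
    ((h₂.continuousOn_envelope ha hav).sub (h₁.continuousOn_envelope ha hav)).mono
      fun y hy => hlo0.trans hy.1
  -- Values of bidder 2 between the two thresholds bid in (y, hi], so his envelope at y is at most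
  -- X₂ hi ≤ X₁ hi; then let y tend to hi.
  have hWhi : W hi ≤ 0 := by
    have hcl : ∀ y ∈ Ico lo hi, W y ≤
        X₁ hi - linearEnvelope X₁ t₁ a vbar y := by
      intro y hy
      have hy0 : 0 ≤ y := hlo0.trans hy.1
      have hhi0 : 0 ≤ hi := hlo0.trans hlohi'
      have hlt : max (bidThreshold t₂ vbar y) a < bidThreshold t₂ vbar hi :=
        (max_lt (hin y hy.1 hy.2) (hav₀.trans_le (hlo1 y hy.1))).trans_le
          ((bidThreshold_mono hy.2.le).trans hhi1)
      obtain ⟨v, hv, hv'⟩ := exists_between hlt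
      have hva : a < v := (le_max_right _ _).trans_lt hv
      have hvb' : v ≤ vbar := hv'.le.trans (bidThreshold_le hvb.le _)
      have hvI : v ∈ Icc 0 vbar := ⟨by linarith, hvb'⟩
      have g1 : y < t₂ v := lt_of_bidThreshold_lt hvI ((le_max_left _ _).trans_lt hv)
      have g2 : t₂ v ≤ hi := le_of_lt_bidThreshold ht₂ hvI hv'
      have g3 := h₂.envelope_mono ha hav hy0 g1.le
      rw [h₂.envelope_bid ha ⟨hva.le, hvb'⟩] at g3
      have g4 := hX₂ (h₂ v hvI).1 hhi0 g2
      have g5 := h₂₁ hi hhi0 hhi1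
      simp only [hW]
      linarith
    have hmem : hi ∈ closure (Ico lo hi) := by
      rw [closure_Ico hlohi.ne]; exact ⟨hlohi', le_rfl⟩
    have hcI : closure (Ico lo hi) = Icc lo hi := closure_Ico hlohi.ne
    have := le_on_closure hcl (hcI ▸ hWc) (hcI ▸ (continuousOn_const.sub
      ((h₁.continuousOn_envelope ha hav).mono fun y hy => hlo0.trans hy.1))) hmem
    have g := h₁.le_envelope ha hav (hlo0.trans hlohi')
    linarith
  -- A maximum of W cannot sit left of `hi`, as W still rises there; at `hi` it would exceed W lo ≥
  -- 0, against W hi ≤ 0. No differentiation is involved.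
  obtain ⟨b, hb, hmax⟩ := isCompact_Icc.exists_isMaxOn (nonempty_Icc.2 hlohi') hWc
  rcases hb.2.lt_or_eq with hbh | hbh
  · obtain ⟨z, hz, hbz⟩ := hstep b hb.1 hbh
    exact absurd (hmax hz) (not_le.2 hbz)
  · obtain ⟨z, hz, hbz⟩ := hstep lo le_rfl hlohi
    have g := hmax hz
    simp only [mem_ofPred_eq, hbh] at g
    linarith

/-- The envelope formula: increments squeezed between the end values of a monotone slope are
integrals of this slope. -/
lemma integral_eq_sub_of_slope_bounds {f u : ℝ → ℝ} {a b : ℝ} (hab : a ≤ b)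
    (hf : MonotoneOn f (Icc a b))
    (hl : ∀ x ∈ Icc a b, ∀ y ∈ Icc a b, x ≤ y → f x * (y - x) ≤ u y - u x)
    (hr : ∀ x ∈ Icc a b, ∀ y ∈ Icc a b, x ≤ y → u y - u x ≤ f y * (y - x)) :
    ∫ z in a..b, f z = u b - u a := by
  set g := fun x => (u x - u a) - ∫ z in a..x, f z with hg
  have hint : ∀ x ∈ Icc a b, ∀ y ∈ Icc a b, x ≤ y → IntervalIntegrable f volume x y := by
    intro x hx y hy hxy
    apply MonotoneOn.intervalIntegrable
    rw [uIcc_of_le hxy]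
    exact hf.mono (Icc_subset_Icc hx.1 hy.2)
  have haI : a ∈ Icc a b := ⟨le_rfl, hab⟩
  -- Both the increment of u and the integral of f lie between f x (y - x) and f y (y - x).
  have hstep : ∀ x ∈ Icc a b, ∀ y ∈ Icc a b, x ≤ y →
      |g y - g x| ≤ (y - x) * (f y - f x) := by
    intro x hx y hy hxy
    have e : g y - g x = (u y - u x) - ∫ z in x..y, f z := by
      simp only [hg]
      rw [← intervalIntegral.integral_add_adjacent_intervals (hint a haI x hx hx.1)
        (hint x hx y hy hxy)]
      ring
    have e1 : f x * (y - x) ≤ ∫ z in x..y, f z := by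
      have := intervalIntegral.integral_mono_on hxy intervalIntegrable_const
        (hint x hx y hy hxy) (f := fun _ => f x)
        (fun z hz => hf hx ⟨hx.1.trans hz.1, hz.2.trans hy.2⟩ hz.1)
      simpa [mul_comm] using this
    have e2 : ∫ z in x..y, f z ≤ f y * (y - x) := by
      have := intervalIntegral.integral_mono_on hxy (hint x hx y hy hxy)
        intervalIntegrable_const (g := fun _ => f y)
        (fun z hz => hf ⟨hx.1.trans hz.1, hz.2.trans hy.2⟩ hy hz.2)
      simpa [mul_comm] using this
    have e3 := hl x hx y hy hxy
    have e4 := hr x hx y hy hxy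
    rw [e, abs_le]
    constructor <;> nlinarith
  -- Over N equal pieces these errors telescope to (b - a) (f b - f a) / N.
  have hN : ∀ N : ℕ, 0 < N → |g b| ≤ (b - a) * (f b - f a) / N := by
    intro N hN
    have hN' : (0 : ℝ) < N := by exact_mod_cast hN
    set p : ℕ → ℝ := fun k => a + (b - a) * (k / N) with hp
    have hpI : ∀ k ≤ N, p k ∈ Icc a b := by
      intro k hk
      have h1 : (k : ℝ) / N ≤ 1 := by
        rw [div_le_one hN']; exact_mod_cast hk
      have h0 : (0 : ℝ) ≤ k / N := by positivity
      constructor <;> simp only [hp] <;> nlinarith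
    have hind : ∀ k ≤ N, |g (p k)| ≤ (b - a) / N * (f (p k) - f a) := by
      intro k
      induction k with
      | zero => intro _; simp [hp, hg]
      | succ k ih =>
        intro hk
        have hd : p (k + 1) - p k = (b - a) / N := by
          simp only [hp]; push_cast; field_simp; ring
        have hd0 : 0 ≤ (b - a) / N := div_nonneg (by linarith) hN'.le
        have h1 := ih (by omega)
        have h2 := hstep (p k) (hpI k (by omega)) (p (k + 1)) (hpI _ hk) (by linarith)
        rw [hd] at h2
        have h3 := abs_add_le (g (p (k + 1)) - g (p k)) (g (p k))
        rw [sub_add_cancel] at h3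
        linarith
    have := hind N le_rfl
    have hpN : p N = b := by simp only [hp]; field_simp; ring
    rw [hpN] at this
    convert this using 1
    ring
  have hg0 : |g b| ≤ 0 := by
    have ht : Filter.Tendsto (fun N : ℕ => (b - a) * (f b - f a) / (N : ℝ)) Filter.atTop
        (nhds 0) := tendsto_const_div_atTop_nhds_zero_nat _
    exact ge_of_tendsto ht (Filter.eventually_atTop.2 ⟨1, fun N h => hN N h⟩)
  have := abs_nonpos_iff.1 hg0
  simp only [hg] at this
  linarith

/-! ### Counting rivals and winning probabilities. -/

instance valueLaw.instIsProbabilityMeasure (n : ℕ) (F : Measure ℝ) [IsProbabilityMeasure F] :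
    IsProbabilityMeasure (valueLaw n F) := by
  unfold valueLaw; infer_instance

/-- The number of rivals `j` of bidder `i` whose value lies in `A j`. -/
noncomputable def rivalCount {n : ℕ} (A : Fin n → Set ℝ) (i : Fin n) (w : Fin n → ℝ) : ℕ :=
  ({j | j ≠ i ∧ w j ∈ A j} : Set (Fin n)).ncard

/-- The expected fraction of a bidder `i` who wins if and only if fewer than `n / 4` rivals `j` have
a value in `A j`. -/
noncomputable def winFraction {n : ℕ} (F : Measure ℝ) (i : Fin n) (A : Fin n → Set ℝ) : ℝ :=
  4 / (n : ℝ) * (valueLaw n F).real {w | rivalCount A i w < n / 4}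

section Count

variable {n : ℕ} {A B : Fin n → Set ℝ} {i : Fin n} {w w' : Fin n → ℝ}

lemma rivalCount_le (h : ∀ j, j ≠ i → w j ∈ A j → w' j ∈ B j) :
    rivalCount A i w ≤ rivalCount B i w' :=
  ncard_le_ncard (fun j hj => ⟨hj.1, h j hj.1 hj.2⟩) (toFinite _)

lemma rivalCount_eq_zero (h : ∀ j, j ≠ i → w j ∉ A j) : rivalCount A i w = 0 := by
  rw [rivalCount, ncard_eq_zero (toFinite _)]
  exact eq_empty_of_forall_notMem fun j hj => h j hj.1 hj.2

lemma rivalCount_eq_sub_one (h : ∀ j, j ≠ i → w j ∈ A j) : rivalCount A i w = n - 1 := by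
  have : ({j | j ≠ i ∧ w j ∈ A j} : Set (Fin n)) = {i}ᶜ := by
    ext j
    simpa using fun hj => h j hj
  rw [rivalCount, this, ncard_compl, ncard_singleton, Nat.card_eq_fintype_card, Fintype.card_fin]

lemma measurable_ncard_setOf {Ω : Type*} [MeasurableSpace Ω] {P : Fin n → Ω → Prop}
    (hP : ∀ j, MeasurableSet {x | P j x}) :
    Measurable fun x => ({j | P j x} : Set (Fin n)).ncard := by
  classical
  have : (fun x => ({j | P j x} : Set (Fin n)).ncard) = fun x => ∑ j, if P j x then 1 else 0 := by
    ext x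
    rw [ncard_eq_toFinset_card', ← Finset.card_filter]
    congr 1
    ext j
    simp
  rw [this]
  exact Finset.measurable_sum _ fun j _ => Measurable.ite (hP j) measurable_const measurable_const

lemma measurable_rivalCount (hA : ∀ j, MeasurableSet (A j)) : Measurable (rivalCount A i) := by
  refine measurable_ncard_setOf fun j => ?_
  by_cases hj : j = i
  · simp [hj]
  · simp only [ne_eq, hj, not_false_eq_true, true_and]
    exact measurable_pi_apply j (hA j)

lemma measurableSet_rivalCount_lt (hA : ∀ j, MeasurableSet (A j)) (k : ℕ) :
    MeasurableSet {w | rivalCount A i w < k} :=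
  measurable_rivalCount hA measurableSet_Iio

/-- An integer m + 1 is at most n/4 exactly when it is at most ⌊n/4⌋. This reconciles the real
quotient in x̂ with the number of places. -/
lemma natCast_le_div_four_sub_one_iff (m n : ℕ) : (m : ℝ) ≤ (n : ℝ) / 4 - 1 ↔ m < n / 4 := by
  rw [le_sub_iff_add_le, le_div_iff₀ (by norm_num), ← Nat.succ_le_iff, Nat.le_div_iff_mul_le
    (by norm_num)]
  exact_mod_cast Iff.rfl

end Count

section WinFraction

variable {n : ℕ} {F : Measure ℝ} {A B : Fin n → Set ℝ} {i : Fin n}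

lemma rankInterimAlloc_eq_winFraction (v : ℝ) :
    rankInterimAlloc F i v = winFraction F i fun _ => Ici v := by
  simp only [rankInterimAlloc, winFraction, rivalCount, natCast_le_div_four_sub_one_iff, mem_Ici]

lemma winFraction_eq_zero_of_div_eq_zero (hn : n / 4 = 0) : winFraction F i A = 0 := by
  simp [winFraction, hn]

lemma winFraction_eq_integral (hA : ∀ j, MeasurableSet (A j)) :
    winFraction F i A = ∫ w, (if rivalCount A i w < n / 4 then 4 / (n : ℝ) else 0)
      ∂(valueLaw n F) := by
  have : (fun w => if rivalCount A i w < n / 4 then 4 / (n : ℝ) else 0) =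
      {w | rivalCount A i w < n / 4}.indicator fun _ => 4 / (n : ℝ) := by
    ext w; simp [indicator_apply]
  rw [this, integral_indicator_const _ (measurableSet_rivalCount_lt hA _), winFraction, mul_comm,
    smul_eq_mul]

variable [IsProbabilityMeasure F]

lemma winFraction_le : winFraction F i A ≤ 4 / n :=
  mul_le_of_le_one_right (by positivity) measureReal_le_one

lemma winFraction_anti (h : ∀ j, j ≠ i → A j ≤ᵐ[F] B j) :
    winFraction F i B ≤ winFraction F i A := by
  refine mul_le_mul_of_nonneg_left ?_ (by positivity)
  refine ENNReal.toReal_mono (measure_ne_top _ _) (measure_mono_ae ?_)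
  have hall : ∀ᵐ w ∂(valueLaw n F), ∀ j, j ≠ i → w j ∈ A j → w j ∈ B j := by
    rw [ae_all_iff]
    intro j
    by_cases hj : j = i
    · simp [hj]
    · have := (Measure.tendsto_eval_ae_ae (μ := fun _ : Fin n => F) (i := j)).eventually (h j hj)
      filter_upwards [this] with w hw _ using hw
  filter_upwards [hall] with w hw hlt
  exact (rivalCount_le hw).trans_lt hlt

lemma winFraction_congr (h : ∀ j, j ≠ i → A j =ᵐ[F] B j) :
    winFraction F i A = winFraction F i B :=
  le_antisymm (winFraction_anti fun j hj => (h j hj).symm.le)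
    (winFraction_anti fun j hj => (h j hj).le)

/-- Values are identically distributed, so relabelling the bidders preserves the law of the profile.
-/
lemma winFraction_perm (σ : Equiv.Perm (Fin n)) :
    winFraction F (σ i) A = winFraction F i (fun j => A (σ j)) := by
  unfold winFraction
  congr 1
  have hmp := measurePreserving_piCongrLeft (fun _ : Fin n => F) σ
  have := hmp.measure_preimage_equiv {w | rivalCount A (σ i) w < n / 4}
  rw [measureReal_def, measureReal_def, valueLaw, ← this]
  congr 2
  ext w
  rw [mem_preimage, mem_ofPred_eq, mem_ofPred_eq]
  have : rivalCount A (σ i) (MeasurableEquiv.piCongrLeft (fun _ => ℝ) σ w)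
      = rivalCount (fun j => A (σ j)) i w := by
    unfold rivalCount
    rw [← ncard_image_of_injective {j | j ≠ i ∧ w j ∈ A (σ j)} σ.injective]
    congr 1
    ext j
    rw [mem_image]
    constructor
    · intro hj
      refine ⟨σ.symm j, ⟨fun h => hj.1 (by rw [← h]; simp), ?_⟩, by simp⟩
      have e := MeasurableEquiv.piCongrLeft_apply_apply (β := fun _ => ℝ) σ w (σ.symm j)
      rw [Equiv.apply_symm_apply] at e
      rw [← e, Equiv.apply_symm_apply]
      exact hj.2
    · rintro ⟨l, hl, rfl⟩
      refine ⟨fun h => hl.1 (σ.injective h), ?_⟩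
      rw [MeasurableEquiv.piCongrLeft_apply_apply (β := fun _ => ℝ) σ w l]
      exact hl.2
  rw [this]

/-- A bidder does better than a rival whose set is smaller than his own. -/
lemma winFraction_le_of_ae_le {i' : Fin n} (h : A i' ≤ᵐ[F] A i) :
    winFraction F i' A ≤ winFraction F i A := by
  -- Swapping the labels moves i to the place of i'; the only rival set to compare is then A i'
  -- against the larger A i.
  have e : winFraction F i A = winFraction F i' (fun j => A (Equiv.swap i i' j)) := by
    rw [← winFraction_perm, Equiv.swap_apply_right]
  rw [e]
  refine winFraction_anti fun j hj => ?_
  by_cases hji : j = i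
  · subst hji; simpa using h
  · rw [Equiv.swap_apply_of_ne_of_ne hji hj]
    exact Filter.EventuallyLE.rfl

lemma integrable_ite_rivalCount (hA : ∀ j, MeasurableSet (A j)) (c : ℝ) :
    Integrable (fun w => if rivalCount A i w < n / 4 then c else 0) (valueLaw n F) := by
  refine Integrable.of_bound (C := |c|) ?_ ?_
  · exact (Measurable.ite (measurableSet_rivalCount_lt hA _) measurable_const
      measurable_const).aestronglyMeasurable
  · refine Filter.Eventually.of_forall fun w => ?_
    split_ifs <;> simp

end WinFraction

/-! ### The allocation rule and its ties. -/

section Auction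

variable {n : ℕ} {F : Measure ℝ} {s : Fin n → ℝ → ℝ} {i : Fin n}

lemma topQuarterAllPay_alloc_nonneg (b : Fin n → ℝ) : 0 ≤ (topQuarterAllPay n).alloc b i :=
  mul_nonneg (by positivity) (le_max_left _ _)

lemma topQuarterAllPay_alloc_le (b : Fin n → ℝ) : (topQuarterAllPay n).alloc b i ≤ 4 / n :=
  mul_le_of_le_one_right (by positivity) (max_le zero_le_one (min_le_left _ _))

lemma measurable_bidsAgainst (hs : ∀ j, Measurable (s j)) (b : ℝ) :
    Measurable (bidsAgainst s i b) := by
  refine measurable_pi_iff.2 fun j => ?_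
  by_cases hj : j = i
  · subst hj; simp [bidsAgainst]
  · simpa [bidsAgainst, Function.update_of_ne hj, Function.comp_def] using (hs j).comp (measurable_pi_apply j)

lemma measurable_topQuarterAllPay_alloc :
    Measurable fun b : Fin n → ℝ => (topQuarterAllPay n).alloc b i := by
  have h1 : Measurable fun b : Fin n → ℝ => ({j | b i < b j} : Set (Fin n)).ncard :=
    measurable_ncard_setOf fun j => measurableSet_lt (measurable_pi_apply i) (measurable_pi_apply j)
  have h2 : Measurable fun b : Fin n → ℝ => ({j | b j = b i} : Set (Fin n)).ncard :=
    measurable_ncard_setOf fun j =>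
      measurableSet_eq_fun (measurable_pi_apply j) (measurable_pi_apply i)
  have hc : Measurable fun m : ℕ => (m : ℝ) := measurable_from_top
  unfold topQuarterAllPay
  exact (measurable_const.max (measurable_const.min
    ((measurable_const.sub (hc.comp h1)).div (hc.comp h2)))).const_mul _

variable [IsProbabilityMeasure F]

lemma integrable_topQuarterAllPay_alloc (hs : ∀ j, Measurable (s j)) (b : ℝ) :
    Integrable (fun w => (topQuarterAllPay n).alloc (bidsAgainst s i b w) i) (valueLaw n F) := by
  refine Integrable.of_bound (C := 4 / n) ?_ ?_
  · exact (measurable_topQuarterAllPay_alloc.comp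
      (measurable_bidsAgainst hs b)).aestronglyMeasurable
  · refine Filter.Eventually.of_forall fun w => ?_
    rw [Real.norm_of_nonneg (topQuarterAllPay_alloc_nonneg _)]
    exact topQuarterAllPay_alloc_le _

lemma ncard_bidsAgainst_lt (b : ℝ) (w : Fin n → ℝ) :
    ({j | bidsAgainst s i b w i < bidsAgainst s i b w j} : Set (Fin n)).ncard =
      rivalCount (fun j => {z | b < s j z}) i w := by
  unfold rivalCount
  congr 1
  ext j
  by_cases hj : j = i
  · subst hj; simp [bidsAgainst]
  · simp [bidsAgainst, hj]

/-- The upper bound counts every tie as won: once ⌊n/4⌋ rivals are strictly above, no place remains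
to be shared. -/
lemma alloc_le_ite (b : ℝ) (w : Fin n → ℝ) :
    (topQuarterAllPay n).alloc (bidsAgainst s i b w) i ≤
      if rivalCount (fun j => {z | b < s j z}) i w < n / 4 then 4 / (n : ℝ) else 0 := by
  split_ifs with h
  · exact topQuarterAllPay_alloc_le _
  · have hle : (((n / 4 : ℕ) : ℝ)) ≤ rivalCount (fun j => {z | b < s j z}) i w := by
      exact_mod_cast not_lt.1 h
    simp only [topQuarterAllPay, ncard_bidsAgainst_lt]
    have : (((n / 4 : ℕ) : ℝ) - rivalCount (fun j => {z | b < s j z}) i w) /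
        ({j | bidsAgainst s i b w j = bidsAgainst s i b w i} : Set (Fin n)).ncard ≤ 0 :=
      div_nonpos_of_nonpos_of_nonneg (by linarith) (by positivity)
    rw [max_eq_left ((min_le_right _ _).trans this), mul_zero]

/-- Raising the bid wins every tie at b: whoever bids at least b' bids more than b, so the whole tie
at b' fits into the remaining places. -/
lemma ite_le_alloc {b b' : ℝ} (hb : b < b') (w : Fin n → ℝ) :
    (if rivalCount (fun j => {z | b < s j z}) i w < n / 4 then 4 / (n : ℝ) else 0) ≤
      (topQuarterAllPay n).alloc (bidsAgainst s i b' w) i := by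
  split_ifs with h
  swap
  · exact topQuarterAllPay_alloc_nonneg _
  -- The additional one is bidder i, a member of his own tie.
  have hAT : ({j | bidsAgainst s i b' w i < bidsAgainst s i b' w j} : Set (Fin n)).ncard +
      ({j | bidsAgainst s i b' w j = bidsAgainst s i b' w i} : Set (Fin n)).ncard ≤
      rivalCount (fun j => {z | b < s j z}) i w + 1 := by
    rw [← ncard_union_eq ?_ (toFinite _) (toFinite _), rivalCount]
    · refine (ncard_le_ncard ?_ (toFinite _)).trans (ncard_insert_le i _)
      intro j hj
      by_cases hji : j = i
      · exact Or.inl hji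
      · refine Or.inr ⟨hji, ?_⟩
        simp only [bidsAgainst, mem_union, mem_ofPred_eq, Function.update_self,
          Function.update_of_ne hji] at hj
        exact hb.trans_le (hj.elim le_of_lt ge_of_eq)
    · exact disjoint_left.2 fun j hj hj' => ne_of_lt hj hj'.symm
  have hT : 0 < ({j | bidsAgainst s i b' w j = bidsAgainst s i b' w i} : Set (Fin n)).ncard :=
    (ncard_pos (toFinite _)).2 ⟨i, rfl⟩
  simp only [topQuarterAllPay]
  have h1 : (1 : ℝ) ≤ (((n / 4 : ℕ) : ℝ) -
      ({j | bidsAgainst s i b' w i < bidsAgainst s i b' w j} : Set (Fin n)).ncard) /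
      ({j | bidsAgainst s i b' w j = bidsAgainst s i b' w i} : Set (Fin n)).ncard := by
    rw [le_div_iff₀ (by exact_mod_cast hT), one_mul, le_sub_iff_add_le]
    exact_mod_cast (by omega)
  rw [min_eq_left h1, max_eq_right zero_le_one, mul_one]

lemma interimAlloc_le_winFraction (hs : ∀ j, Measurable (s j)) (b : ℝ) :
    interimAlloc F (topQuarterAllPay n) s i b ≤ winFraction F i fun j => {z | b < s j z} := by
  have hA : ∀ j, MeasurableSet {z | b < s j z} := fun j => hs j measurableSet_Ioi
  rw [winFraction_eq_integral hA]
  exact integral_mono (integrable_topQuarterAllPay_alloc hs b) (integrable_ite_rivalCount hA _)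
    fun w => alloc_le_ite b w

lemma winFraction_le_interimAlloc (hs : ∀ j, Measurable (s j)) {b b' : ℝ} (hb : b < b') :
    winFraction F i (fun j => {z | b < s j z}) ≤ interimAlloc F (topQuarterAllPay n) s i b' := by
  have hA : ∀ j, MeasurableSet {z | b < s j z} := fun j => hs j measurableSet_Ioi
  rw [winFraction_eq_integral hA]
  exact integral_mono (integrable_ite_rivalCount hA _) (integrable_topQuarterAllPay_alloc hs b')
    fun w => ite_le_alloc hb w

/-- Ties of positive probability are harmful. -/
lemma interimAlloc_lt_winFraction (hs : ∀ j, Measurable (s j)) (hn : n / 4 ≠ 0) {b : ℝ}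
    (hb : ∀ j, F {z | s j z = b} ≠ 0) :
    interimAlloc F (topQuarterAllPay n) s i b < winFraction F i fun j => {z | b < s j z} := by
  have hA : ∀ j, MeasurableSet {z | b < s j z} := fun j => hs j measurableSet_Ioi
  have hi1 := integrable_topQuarterAllPay_alloc (F := F) (i := i) hs b
  have hi2 := integrable_ite_rivalCount (F := F) (i := i) hA (4 / (n : ℝ))
  rw [winFraction_eq_integral hA, ← sub_pos, interimAlloc, ← integral_sub hi2 hi1]
  refine (integral_pos_iff_support_of_nonneg (fun w => sub_nonneg.2 (alloc_le_ite b w))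
    (hi2.sub hi1)).2 ?_
  -- On the event that everybody bids b, all n bidders share ⌊n/4⌋ < n places.
  have hpos : 0 < valueLaw n F (univ.pi fun j => {z | s j z = b}) := by
    rw [valueLaw, Measure.pi_pi]
    exact pos_iff_ne_zero.2 (Finset.prod_ne_zero_iff.2 fun j _ => hb j)
  refine hpos.trans_le (measure_mono fun w hw => ?_)
  have hw' : ∀ j, s j (w j) = b := fun j => hw j (mem_univ j)
  have h0 : rivalCount (fun j => {z | b < s j z}) i w = 0 :=
    rivalCount_eq_zero fun j _ => by simp [hw' j]
  have hT : ({j | bidsAgainst s i b w j = bidsAgainst s i b w i} : Set (Fin n)).ncard = n := by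
    have : ({j | bidsAgainst s i b w j = bidsAgainst s i b w i} : Set (Fin n)) = univ := by
      ext j
      by_cases hj : j = i
      · simp [hj]
      · simp [bidsAgainst, hj, hw' j]
    rw [this, ncard_univ, Nat.card_eq_fintype_card, Fintype.card_fin]
  have hk : n / 4 < n := Nat.div_lt_self (by omega) (by norm_num)
  have hn0 : (0 : ℝ) < n := by exact_mod_cast (by omega : 0 < n)
  have hlt : ((n / 4 : ℕ) : ℝ) / n < 1 := by
    rw [div_lt_one hn0]; exact_mod_cast hk
  simp only [Function.mem_support, h0, if_pos (Nat.pos_of_ne_zero hn), topQuarterAllPay,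
    ncard_bidsAgainst_lt, hT, Nat.cast_zero, sub_zero]
  rw [min_eq_right hlt.le, max_eq_right (by positivity)]
  have : 0 < 4 / (n : ℝ) * (1 - ((n / 4 : ℕ) : ℝ) / n) := mul_pos (by positivity) (by linarith)
  intro h
  linarith

lemma interimCost_topQuarterAllPay (c : ℝ → ℝ) (b : ℝ) :
    interimCost F c (topQuarterAllPay n) s i b = c b := by
  simp [interimCost, topQuarterAllPay, bidsAgainst]

end Auction

/-! ### Consequences of the support being an interval. -/

section Support

variable {F : Measure ℝ} {vbar : ℝ} (hsupp : F.support = Icc 0 vbar)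
include hsupp

lemma ae_mem_Icc_of_support : ∀ᵐ v ∂F, v ∈ Icc 0 vbar := by
  rw [← hsupp]; exact Measure.support_mem_ae

lemma measure_Ioo_pos_of_support {a b : ℝ} (ha : 0 ≤ a) (hab : a < b) (hb : b ≤ vbar) :
    0 < F (Ioo a b) := by
  have hm : (a + b) / 2 ∈ F.support := by
    rw [hsupp]; constructor <;> linarith
  rw [Measure.mem_support_iff_forall] at hm
  exact hm _ (Ioo_mem_nhds (by linarith) (by linarith))

lemma vbar_pos_of_support [IsProbabilityMeasure F] [NullSingletonClass F] : 0 < vbar := by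
  by_contra! h
  have h0 : F (Icc 0 vbar) = 1 := by
    rw [← prob_compl_eq_zero_iff measurableSet_Icc]
    exact ae_mem_Icc_of_support hsupp
  have h1 : F (Icc 0 vbar) ≤ F {0} := measure_mono fun x hx => by
    simpa using le_antisymm (hx.2.trans h) hx.1
  rw [h0, measure_singleton] at h1
  simp at h1

end Support

/-! ### The rank allocation and the cost it induces. -/

section RankAlloc

variable {n : ℕ} {F : Measure ℝ} [IsProbabilityMeasure F] {i : Fin n}

lemma monotone_rankInterimAlloc : Monotone (rankInterimAlloc F i) := by
  intro v w hvw
  simp only [rankInterimAlloc_eq_winFraction]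
  exact winFraction_anti fun _ _ => (Ici_subset_Ici.2 hvw).eventuallyLE

lemma intervalIntegrable_rankInterimAlloc (a b : ℝ) :
    IntervalIntegrable (rankInterimAlloc F i) volume a b :=
  monotone_rankInterimAlloc.intervalIntegrable

lemma mul_rankInterimAlloc_le_integral (v z : ℝ) :
    (v - z) * rankInterimAlloc F i z ≤ ∫ y in z..v, rankInterimAlloc F i y := by
  rcases le_total z v with h | h
  · have := intervalIntegral.integral_mono_on h intervalIntegrable_const
      (intervalIntegrable_rankInterimAlloc (F := F) (i := i) z v)
      (f := fun _ => rankInterimAlloc F i z) fun y hy => monotone_rankInterimAlloc hy.1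
    simpa using this
  · have := intervalIntegral.integral_mono_on h
      (intervalIntegrable_rankInterimAlloc (F := F) (i := i) v z) intervalIntegrable_const
      (g := fun _ => rankInterimAlloc F i z) fun y hy => monotone_rankInterimAlloc hy.2
    rw [intervalIntegral.integral_symm]
    simp only [intervalIntegral.integral_const, smul_eq_mul] at this
    linarith

/-- The cost `v x̂(v) - ∫₀ᵛ x̂` of the equilibrium bid. -/
noncomputable def equilibriumCost {n : ℕ} (F : Measure ℝ) (i : Fin n) (v : ℝ) : ℝ :=
  v * rankInterimAlloc F i v - ∫ z in (0 : ℝ)..v, rankInterimAlloc F i z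

lemma equilibriumCost_sub (a b : ℝ) :
    equilibriumCost F i b - equilibriumCost F i a =
      b * rankInterimAlloc F i b - a * rankInterimAlloc F i a -
        ∫ z in a..b, rankInterimAlloc F i z := by
  rw [equilibriumCost, equilibriumCost, ← intervalIntegral.integral_add_adjacent_intervals
    (intervalIntegrable_rankInterimAlloc 0 a) (intervalIntegrable_rankInterimAlloc a b)]
  ring

/-- Truth-telling is optimal when a report `z` receives `x̂(z)` at the cost of its bid. -/
lemma equilibriumCost_bic (v z : ℝ) :
    v * rankInterimAlloc F i z - equilibriumCost F i z ≤
      v * rankInterimAlloc F i v - equilibriumCost F i v := by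
  have h1 := equilibriumCost_sub (F := F) (i := i) z v
  have h2 := mul_rankInterimAlloc_le_integral (F := F) (i := i) v z
  linarith

/-- Value a must not gain by imitating b. This drives both the strict monotonicity of bids and the
lower bound on revenue. -/
lemma mul_sub_le_equilibriumCost_sub (a b : ℝ) :
    a * (rankInterimAlloc F i b - rankInterimAlloc F i a) ≤
      equilibriumCost F i b - equilibriumCost F i a := by
  have h1 := equilibriumCost_bic (F := F) (i := i) a b
  linarith

omit [IsProbabilityMeasure F] in
lemma equilibriumCost_zero : equilibriumCost F i 0 = 0 := by simp [equilibriumCost]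

lemma equilibriumCost_monotoneOn : MonotoneOn (equilibriumCost F i) (Ici 0) := by
  intro a ha b _ hab
  have h1 := mul_sub_le_equilibriumCost_sub (F := F) (i := i) a b
  have h2 := mul_nonneg ha (sub_nonneg.2 (monotone_rankInterimAlloc (F := F) (i := i) hab))
  linarith

omit [IsProbabilityMeasure F] in
lemma rankInterimAlloc_eq_zero_of_div_eq_zero (hn : n / 4 = 0) (v : ℝ) :
    rankInterimAlloc F i v = 0 := by
  rw [rankInterimAlloc_eq_winFraction, winFraction_eq_zero_of_div_eq_zero hn]

variable {vbar : ℝ} (hsupp : F.support = Icc 0 vbar)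
include hsupp

lemma rankInterimAlloc_of_nonpos {v : ℝ} (hv : v ≤ 0) : rankInterimAlloc F i v = 0 := by
  have h : (Ici v : Set ℝ) =ᵐ[F] univ := by
    filter_upwards [ae_mem_Icc_of_support hsupp] with w hw
    exact propext ⟨fun _ => trivial, fun _ => hv.trans hw.1⟩
  rw [rankInterimAlloc_eq_winFraction, winFraction_congr fun _ _ => h, winFraction]
  have : {w : Fin n → ℝ | rivalCount (fun _ => univ) i w < n / 4} = ∅ := by
    refine eq_empty_of_forall_notMem fun w hw => ?_
    have hn : 0 < n := i.pos
    rw [mem_ofPred_eq, rivalCount_eq_sub_one fun _ _ => mem_univ _] at hw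
    omega
  rw [this]
  simp

lemma equilibriumCost_of_nonpos {v : ℝ} (hv : v ≤ 0) : equilibriumCost F i v = 0 := by
  have : ∫ z in (0 : ℝ)..v, rankInterimAlloc F i z = ∫ z in (0 : ℝ)..v, (0 : ℝ) := by
    refine intervalIntegral.integral_congr fun z hz => ?_
    rw [uIcc_of_ge hv] at hz
    exact rankInterimAlloc_of_nonpos hsupp hz.2
  rw [equilibriumCost, rankInterimAlloc_of_nonpos hsupp hv, this]
  simp

lemma equilibriumCost_nonneg (v : ℝ) : 0 ≤ equilibriumCost F i v := by
  rcases le_total v 0 with h | h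
  · rw [equilibriumCost_of_nonpos hsupp h]
  · have := equilibriumCost_monotoneOn (F := F) (i := i) (mem_Ici.2 le_rfl) h h
    rwa [equilibriumCost_zero] at this

lemma equilibriumCost_monotone : Monotone (equilibriumCost F i) := by
  intro a b hab
  rcases le_total a 0 with h | h
  · rw [equilibriumCost_of_nonpos hsupp h]; exact equilibriumCost_nonneg hsupp b
  · exact equilibriumCost_monotoneOn h (h.trans hab) hab

variable [NullSingletonClass F]

lemma rankInterimAlloc_vbar (hn : n / 4 ≠ 0) : rankInterimAlloc F i vbar = 4 / n := by
  have h : (Ici vbar : Set ℝ) =ᵐ[F] (∅ : Set ℝ) := by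
    have h0 : ∀ᵐ w ∂F, w ≠ vbar := by
      rw [ae_iff]; simp
    filter_upwards [ae_mem_Icc_of_support hsupp, h0] with w hw hw0
    exact propext ⟨fun h => hw0 (le_antisymm hw.2 h), fun h => h.elim⟩
  rw [rankInterimAlloc_eq_winFraction, winFraction_congr fun _ _ => h, winFraction]
  have : {w : Fin n → ℝ | rivalCount (fun _ => ∅) i w < n / 4} = univ := by
    refine eq_univ_of_forall fun w => ?_
    rw [mem_ofPred_eq, rivalCount_eq_zero fun _ _ => notMem_empty _]
    omega
  rw [this]
  simp

omit hsupp in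
-- Almost surely no value equals v₀, and then the count of rivals is locally constant at v₀;
-- dominated convergence concludes.
lemma continuous_rankInterimAlloc : Continuous (rankInterimAlloc F i) := by
  have e : rankInterimAlloc F i = fun v => ∫ w,
      (if rivalCount (fun _ => Ici v) i w < n / 4 then 4 / (n : ℝ) else 0) ∂(valueLaw n F) := by
    ext v
    rw [rankInterimAlloc_eq_winFraction, winFraction_eq_integral fun _ => measurableSet_Ici]
  rw [e]
  refine continuous_iff_continuousAt.2 fun v₀ => ?_
  refine continuousAt_of_dominated (bound := fun _ => |4 / (n : ℝ)|)
    (Filter.Eventually.of_forall fun v =>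
      (integrable_ite_rivalCount (fun _ => measurableSet_Ici) _).1)
    (Filter.Eventually.of_forall fun v => Filter.Eventually.of_forall fun w => ?_)
    (integrable_const _) ?_
  · split_ifs <;> simp [le_abs_self]
  · have hall : ∀ᵐ w ∂(valueLaw n F), ∀ j, w j ≠ v₀ :=
      ae_all_iff.2 fun j => Measure.ae_eval_ne (μ := fun _ : Fin n => F) j v₀
    filter_upwards [hall] with w hw
    have hev : ∀ᶠ v in nhds v₀, ∀ j, (v ≤ w j ↔ v₀ ≤ w j) := by
      rw [Filter.eventually_all]
      intro j
      rcases (hw j).lt_or_gt with h | h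
      · filter_upwards [lt_mem_nhds h] with v hv
        exact ⟨fun h' => absurd hv h'.not_gt, fun h' => absurd h h'.not_gt⟩
      · filter_upwards [gt_mem_nhds h] with v hv
        exact ⟨fun _ => h.le, fun _ => hv.le⟩
    refine ContinuousAt.congr (f := fun _ => if rivalCount (fun _ => Ici v₀) i w < n / 4
      then 4 / (n : ℝ) else 0) continuousAt_const ?_
    filter_upwards [hev] with v hv
    simp only [rivalCount, mem_Ici, hv]

omit hsupp in
lemma continuous_equilibriumCost : Continuous (equilibriumCost F i) :=
  (continuous_id.mul continuous_rankInterimAlloc).sub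
    (intervalIntegral.continuous_primitive (fun a b => intervalIntegrable_rankInterimAlloc a b) 0)

omit [NullSingletonClass F] in
lemma strictMonoOn_rankInterimAlloc (hn : n / 4 ≠ 0) :
    StrictMonoOn (rankInterimAlloc F i) (Icc 0 vbar) := by
  intro v hv w hw hvw
  simp only [rankInterimAlloc_eq_winFraction, winFraction]
  have hn0 : 0 < n := i.pos
  refine mul_lt_mul_of_pos_left ?_ (by positivity)
  set E := {x : Fin n → ℝ | rivalCount (fun _ => Ici v) i x < n / 4} with hE
  set E' := {x : Fin n → ℝ | rivalCount (fun _ => Ici w) i x < n / 4} with hE'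
  have hsub : E ⊆ E' := fun x hx =>
    (rivalCount_le fun j _ hj => hvw.le.trans hj : _ ≤ rivalCount (fun _ => Ici v) i x).trans_lt hx
  -- When all values lie in (v, w), no rival counts against w, while all n - 1 ≥ ⌊n/4⌋ rivals count
  -- against v.
  have hbox : (univ.pi fun _ : Fin n => Ioo v w) ⊆ E' \ E := by
    intro x hx
    constructor
    · rw [hE', mem_ofPred_eq, rivalCount_eq_zero fun j _ => notMem_Ici.2 (hx j trivial).2]
      omega
    · rw [hE, mem_ofPred_eq, rivalCount_eq_sub_one fun j _ => mem_Ici.2 (hx j trivial).1.le]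
      omega
  have hpos : 0 < valueLaw n F (E' \ E) := by
    refine lt_of_lt_of_le ?_ (measure_mono hbox)
    rw [valueLaw, Measure.pi_pi]
    exact pos_iff_ne_zero.2 (Finset.prod_ne_zero_iff.2 fun j _ =>
      (measure_Ioo_pos_of_support hsupp hv.1 hvw hw.2).ne')
  have := measureReal_sdiff hsub (measurableSet_rivalCount_lt (A := fun _ => Ici v) (i := i)
    (fun _ => measurableSet_Ici) (n / 4)) (μ := valueLaw n F)
  have h2 : 0 < (valueLaw n F).real (E' \ E) := ENNReal.toReal_pos hpos.ne' (measure_ne_top _ _)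
  linarith

omit [NullSingletonClass F] in
lemma strictMonoOn_equilibriumCost (hn : n / 4 ≠ 0) :
    StrictMonoOn (equilibriumCost F i) (Icc 0 vbar) := by
  intro a ha b hb hab
  -- The intermediate m is positive even if a = 0, where the increment bound would not be strict.
  obtain ⟨m, ham, hmb⟩ := exists_between hab
  have hm : m ∈ Icc 0 vbar := ⟨ha.1.trans ham.le, hmb.le.trans hb.2⟩
  have h1 := mul_sub_le_equilibriumCost_sub (F := F) (i := i) m b
  have h2 := strictMonoOn_rankInterimAlloc (i := i) hsupp hn hm hb hmb
  have h3 := equilibriumCost_monotoneOn (F := F) (i := i) ha.1 hm.1 ham.le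
  have h4 := mul_pos (ha.1.trans_lt ham) (sub_pos.2 h2)
  linarith

end RankAlloc

/-! ### From costs back to bids. -/

section Bid

variable {n : ℕ} {F : Measure ℝ} [IsProbabilityMeasure F] {i : Fin n} {c : ℝ → ℝ}
  (hc : StrictMonoOn c (Ici 0)) (hc' : c '' Ici 0 = Ici 0)

variable {vbar : ℝ} (hsupp : F.support = Icc 0 vbar)

include hc' hsupp

lemma equilibriumBid_nonneg (v : ℝ) : 0 ≤ equilibriumBid F c i v := by
  have : equilibriumCost F i v ∈ c '' Ici 0 := by
    rw [hc']; exact equilibriumCost_nonneg hsupp v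
  exact Function.invFunOn_mem this

lemma cost_equilibriumBid (v : ℝ) : c (equilibriumBid F c i v) = equilibriumCost F i v := by
  have : equilibriumCost F i v ∈ c '' Ici 0 := by
    rw [hc']; exact equilibriumCost_nonneg hsupp v
  exact Function.invFunOn_eq this

include hc

lemma eq_equilibriumBid {b v : ℝ} (hb : 0 ≤ b) (h : c b = equilibriumCost F i v) :
    b = equilibriumBid F c i v :=
  hc.injOn hb (equilibriumBid_nonneg hc' hsupp v) (h.trans (cost_equilibriumBid hc' hsupp v).symm)

lemma monotone_equilibriumBid : Monotone (equilibriumBid F c i) := by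
  intro v w hvw
  rw [← hc.le_iff_le (equilibriumBid_nonneg hc' hsupp v) (equilibriumBid_nonneg hc' hsupp w),
    cost_equilibriumBid hc' hsupp, cost_equilibriumBid hc' hsupp]
  exact equilibriumCost_monotone hsupp hvw

lemma equilibriumBid_lt_iff {v w : ℝ} : equilibriumBid F c i v < equilibriumBid F c i w ↔
    equilibriumCost F i v < equilibriumCost F i w := by
  rw [← hc.lt_iff_lt (equilibriumBid_nonneg hc' hsupp v) (equilibriumBid_nonneg hc' hsupp w),
    cost_equilibriumBid hc' hsupp, cost_equilibriumBid hc' hsupp]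

end Bid

/-! ### Uniqueness of the equilibrium. -/

section Equilibrium

variable {n : ℕ} {F : Measure ℝ} [IsProbabilityMeasure F] {vbar : ℝ} {c : ℝ → ℝ}
  {s : Fin n → ℝ → ℝ}

/-- The expected fraction of bidder `i` if he spends `y`, the others spend `t`, and he wins all
ties. -/
noncomputable def spendingAlloc {n : ℕ} (F : Measure ℝ) (t : Fin n → ℝ → ℝ) (i : Fin n) (y : ℝ) :
    ℝ :=
  winFraction F i fun j => {z | y < t j z}

lemma monotone_spendingAlloc {t : Fin n → ℝ → ℝ} (i : Fin n) : Monotone (spendingAlloc F t i) := by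
  intro y z hyz
  have hsub : ∀ j, {x | z < t j x} ⊆ {x | y < t j x} := fun j x hx => hyz.trans_lt hx
  exact winFraction_anti fun j _ => (hsub j).eventuallyLE

omit [IsProbabilityMeasure F] in
lemma setOf_lt_ae_eq_Ioi_bidThreshold [NullSingletonClass F] (hsupp : F.support = Icc 0 vbar)
    {t : ℝ → ℝ} (ht : MonotoneOn t (Icc 0 vbar)) (y : ℝ) :
    {z | y < t z} =ᵐ[F] Ioi (bidThreshold t vbar y) := by
  have h0 : ∀ᵐ w ∂F, w ≠ bidThreshold t vbar y := by
    rw [ae_iff]; simp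
  filter_upwards [ae_mem_Icc_of_support hsupp, h0] with z hz hz0
  refine propext ⟨fun h => ?_, fun h => lt_of_bidThreshold_lt hz h⟩
  by_contra! hc
  exact absurd (le_of_lt_bidThreshold ht hz (lt_of_le_of_ne (not_lt.1 hc) hz0)) (not_le.2 h)

variable (hc : StrictMonoOn c (Ici 0)) (hc' : c '' Ici 0 = Ici 0) (hsupp : F.support = Icc 0 vbar)

include hc hsupp in
lemma winFraction_eq_spendingAlloc (h0 : ∀ j, ∀ v ∈ Icc 0 vbar, 0 ≤ s j v) (i : Fin n) {b : ℝ}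
    (hb : 0 ≤ b) :
    winFraction F i (fun j => {z | b < s j z}) = spendingAlloc F (fun j z => c (s j z)) i (c b) := by
  refine winFraction_congr fun j _ => ?_
  filter_upwards [ae_mem_Icc_of_support hsupp] with z hz
  exact propext (hc.lt_iff_lt hb (h0 j z hz)).symm

namespace IsBayesNash

variable (hs : IsBayesNash F vbar c (topQuarterAllPay n) s)
include hc hc' hsupp hs

/-- Spending y + ε wins every tie at y, so an equilibrium must do at least as well up to ε. -/
lemma spendingAlloc_le (i : Fin n) {v : ℝ} (hv : v ∈ Icc 0 vbar) {y : ℝ} (hy : 0 ≤ y) :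
    v * spendingAlloc F (fun j z => c (s j z)) i y - y ≤
      v * interimAlloc F (topQuarterAllPay n) s i (s i v) - c (s i v) := by
  refine le_of_forall_pos_le_add fun ε hε => ?_
  obtain ⟨b, hb, rfl⟩ : y ∈ c '' Ici 0 := by rw [hc']; exact hy
  obtain ⟨b', hb', hbb⟩ : c b + ε ∈ c '' Ici 0 := by rw [hc']; exact mem_Ici.2 (by linarith)
  have hlt : b < b' := by
    rw [← hc.lt_iff_lt hb hb', hbb]; linarith
  have h1 := hs.best_response i v hv b' hb'
  simp only [interimUtility, interimCost_topQuarterAllPay, hbb] at h1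
  have h2 := winFraction_le_interimAlloc (F := F) (i := i) hs.measurable hlt
  rw [winFraction_eq_spendingAlloc hc hsupp hs.nonneg i hb] at h2
  have h3 := mul_le_mul_of_nonneg_left h2 hv.1
  linarith

omit hc' in
lemma interimAlloc_le (i : Fin n) {v : ℝ} (hv : v ∈ Icc 0 vbar) :
    interimAlloc F (topQuarterAllPay n) s i (s i v) ≤
      spendingAlloc F (fun j z => c (s j z)) i (c (s i v)) := by
  have := interimAlloc_le_winFraction (F := F) (i := i) hs.measurable (s i v)
  rwa [winFraction_eq_spendingAlloc hc hsupp hs.nonneg i (hs.nonneg i v hv)] at this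

omit [IsProbabilityMeasure F] hc hsupp in
lemma cost_nonneg (i : Fin n) {v : ℝ} (hv : v ∈ Icc 0 vbar) : 0 ≤ c (s i v) := by
  have : c (s i v) ∈ c '' Ici 0 := mem_image_of_mem c (hs.nonneg i v hv)
  rwa [hc'] at this

/-- Ties drop out of the problem: winning them all is available in the limit, and the actual
allocation is never larger. -/
lemma isBestReply (i : Fin n) :
    IsBestReply (spendingAlloc F (fun j z => c (s j z)) i) (fun z => c (s i z)) vbar := by
  intro v hv
  refine ⟨hs.cost_nonneg hc' i hv, fun y hy => ?_⟩
  have h1 := hs.spendingAlloc_le hc hc' hsupp i hv hy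
  have h2 := mul_le_mul_of_nonneg_left (hs.interimAlloc_le hc hsupp i hv) hv.1
  linarith

/-- Otherwise a marginally higher bid would be a strict gain; a bidder of value 0 would not notice.
-/
lemma interimAlloc_eq (i : Fin n) {v : ℝ} (hv : v ∈ Icc 0 vbar) (hv0 : 0 < v) :
    interimAlloc F (topQuarterAllPay n) s i (s i v) =
      spendingAlloc F (fun j z => c (s j z)) i (c (s i v)) := by
  refine le_antisymm (hs.interimAlloc_le hc hsupp i hv) ?_
  have := hs.spendingAlloc_le hc hc' hsupp i hv (hs.cost_nonneg hc' i hv)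
  exact le_of_mul_le_mul_left (by linarith) hv0

lemma monotoneOn_cost (i : Fin n) : MonotoneOn (fun z => c (s i z)) (Icc 0 vbar) :=
  (hs.isBestReply hc hc' hsupp i).monotoneOn ((monotone_spendingAlloc i).monotoneOn _)

variable [NullSingletonClass F]

/-- The two bidders share all rivals except each other, so only their own thresholds decide who
faces the weaker competition. -/
lemma spendingAlloc_le_of_bidThreshold_le (i i' : Fin n) {y : ℝ}
    (h : bidThreshold (fun z => c (s i' z)) vbar y ≤ bidThreshold (fun z => c (s i z)) vbar y) :
    spendingAlloc F (fun j z => c (s j z)) i y ≤ spendingAlloc F (fun j z => c (s j z)) i' y := by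
  refine winFraction_le_of_ae_le ?_
  have h1 := setOf_lt_ae_eq_Ioi_bidThreshold hsupp (hs.monotoneOn_cost hc hc' hsupp i) y
  have h2 := setOf_lt_ae_eq_Ioi_bidThreshold hsupp (hs.monotoneOn_cost hc hc' hsupp i') y
  exact h1.le.trans ((Ioi_subset_Ioi h).eventuallyLE.trans h2.symm.le)

/-- Every equilibrium is symmetric. -/
lemma bidThreshold_eq (i i' : Fin n) (y : ℝ) :
    bidThreshold (fun z => c (s i z)) vbar y = bidThreshold (fun z => c (s i' z)) vbar y := by
  have key : ∀ i i' : Fin n, bidThreshold (fun z => c (s i z)) vbar y ≤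
      bidThreshold (fun z => c (s i' z)) vbar y := fun i i' =>
    IsBestReply.bidThreshold_le_bidThreshold (vbar_pos_of_support hsupp)
      (hs.isBestReply hc hc' hsupp i) (hs.isBestReply hc hc' hsupp i')
      ((monotone_spendingAlloc i).monotoneOn _) ((monotone_spendingAlloc i').monotoneOn _)
      (fun y _ h => hs.spendingAlloc_le_of_bidThreshold_le hc hc' hsupp i i' h)
      (fun y _ h => hs.spendingAlloc_le_of_bidThreshold_le hc hc' hsupp i' i h) y
  exact le_antisymm (key i i') (key i' i)

/-- In equilibrium there are no ties. -/
lemma strictMonoOn_cost (hn : n / 4 ≠ 0) (i : Fin n) :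
    StrictMonoOn (fun z => c (s i z)) (Icc 0 vbar) := by
  intro v hv w hw hvw
  refine lt_of_le_of_ne (hs.monotoneOn_cost hc hc' hsupp i hv hw hvw.le) fun he => ?_
  simp only at he
  have hw0 : 0 < w := hv.1.trans_lt hvw
  have hub : w ≤ bidThreshold (fun z => c (s i z)) vbar (c (s i w)) := le_bidThreshold hw le_rfl
  -- Thresholds agree across bidders, so a flat piece of one strategy is a flat piece, at the same
  -- bid, of all.
  have htie : ∀ j, ∀ z ∈ Ioo v w, s j z = s i w := by
    intro j z hz
    have hzI : z ∈ Icc 0 vbar := ⟨hv.1.trans hz.1.le, hz.2.le.trans hw.2⟩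
    refine hc.injOn (hs.nonneg j z hzI) (hs.nonneg i w hw) (le_antisymm ?_ ?_)
    · refine le_of_lt_bidThreshold (t := fun z => c (s j z)) (hs.monotoneOn_cost hc hc' hsupp j)
        hzI (hz.2.trans_le ?_)
      rwa [hs.bidThreshold_eq hc hc' hsupp j i]
    · by_contra! hlt
      have h1 : z ≤ bidThreshold (fun z => c (s j z)) vbar (c (s j z)) := le_bidThreshold hzI le_rfl
      rw [hs.bidThreshold_eq hc hc' hsupp j i] at h1
      have h2 := le_of_lt_bidThreshold (hs.monotoneOn_cost hc hc' hsupp i) hv (hz.1.trans_le h1)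
      linarith
  have hpos : ∀ j, F {z | s j z = s i w} ≠ 0 := fun j =>
    ((measure_Ioo_pos_of_support hsupp hv.1 hvw hw.2).trans_le
      (measure_mono fun z hz => htie j z hz)).ne'
  have hlt := interimAlloc_lt_winFraction (F := F) (i := i) hs.measurable hn hpos
  rw [winFraction_eq_spendingAlloc hc hsupp hs.nonneg i (hs.nonneg i w hw),
    hs.interimAlloc_eq hc hc' hsupp i hw hw0] at hlt
  exact lt_irrefl _ hlt

lemma spendingAlloc_eq_rankInterimAlloc (i : Fin n) {v : ℝ} (hv : v ∈ Icc 0 vbar) :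
    spendingAlloc F (fun j z => c (s j z)) i (c (s i v)) = rankInterimAlloc F i v := by
  by_cases hn : n / 4 = 0
  · rw [spendingAlloc, winFraction_eq_zero_of_div_eq_zero hn,
      rankInterimAlloc_eq_zero_of_div_eq_zero hn]
  rw [rankInterimAlloc_eq_winFraction]
  -- Without flat pieces the threshold inverts the bid function.
  have hthr : bidThreshold (fun z => c (s i z)) vbar (c (s i v)) = v := by
    refine le_antisymm (Real.sSup_le (fun z hz => ?_) hv.1) (le_bidThreshold hv le_rfl)
    exact ((hs.strictMonoOn_cost hc hc' hsupp hn i).le_iff_le hz.1 hv).1 hz.2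
  refine winFraction_congr fun j _ => ?_
  refine (setOf_lt_ae_eq_Ioi_bidThreshold hsupp (hs.monotoneOn_cost hc hc' hsupp j) _).trans ?_
  rw [hs.bidThreshold_eq hc hc' hsupp j i, hthr]
  exact Ioi_ae_eq_Ici

/-- The equilibrium utility has slopes squeezed between values of x̂ and vanishes at 0, so it is the
integral of x̂; this determines the cost of the bid. -/
lemma eq_equilibriumBid (i : Fin n) {v : ℝ} (hv : v ∈ Icc 0 vbar) :
    s i v = equilibriumBid F c i v := by
  refine _root_.eq_equilibriumBid hc hc' hsupp (hs.nonneg i v hv) ?_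
  have hbr := hs.isBestReply hc hc' hsupp i
  have hmem : ∀ {x : ℝ}, x ∈ Icc 0 v → x ∈ Icc 0 vbar := fun hx => ⟨hx.1, hx.2.trans hv.2⟩
  have h0 := hbr.zero (hv.1.trans hv.2)
  have hineq : ∀ x ∈ Icc 0 v, ∀ y ∈ Icc 0 v,
      x * rankInterimAlloc F i y - c (s i y) ≤ x * rankInterimAlloc F i x - c (s i x) := by
    intro x hx y hy
    have := (hbr x (hmem hx)).2 (c (s i y)) (hbr y (hmem hy)).1
    rwa [hs.spendingAlloc_eq_rankInterimAlloc hc hc' hsupp i (hmem hx),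
      hs.spendingAlloc_eq_rankInterimAlloc hc hc' hsupp i (hmem hy)] at this
  have := integral_eq_sub_of_slope_bounds (f := rankInterimAlloc F i)
    (u := fun x => x * rankInterimAlloc F i x - c (s i x)) hv.1
    (monotone_rankInterimAlloc.monotoneOn _)
    (fun x hx y hy _ => by linarith [hineq y hy x hx])
    (fun x hx y hy _ => by linarith [hineq x hx y hy])
  rw [equilibriumCost, this, h0]
  ring

end IsBayesNash

/-! ### The candidate is an equilibrium. -/

section Existence

variable [NullSingletonClass F]
include hc hc' hsupp

lemma winFraction_equilibriumBid (hn : n / 4 ≠ 0) (i : Fin n) {v : ℝ} (hv : v ∈ Icc 0 vbar) :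
    winFraction F i (fun j => {z | equilibriumBid F c i v < equilibriumBid F c j z}) =
      rankInterimAlloc F i v := by
  rw [rankInterimAlloc_eq_winFraction]
  refine winFraction_congr fun j _ => Filter.EventuallyEq.trans ?_ Ioi_ae_eq_Ici
  have hij : equilibriumBid F c i v = equilibriumBid F c j v := by
    have : rankInterimAlloc F i = rankInterimAlloc F j := by
      ext z
      simp only [rankInterimAlloc_eq_winFraction]
      exact le_antisymm (winFraction_le_of_ae_le (by rfl)) (winFraction_le_of_ae_le (by rfl))
    simp only [equilibriumBid, this]
  filter_upwards [ae_mem_Icc_of_support hsupp] with z hz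
  rw [hij]
  refine propext ((equilibriumBid_lt_iff hc hc' hsupp).trans ?_)
  exact (strictMonoOn_equilibriumCost hsupp hn).lt_iff_lt hv hz

/-- The lower bound comes from below: the bid of v strictly exceeds that of any z < v and hence wins
at least x̂(z), and x̂ is continuous. -/
lemma interimAlloc_equilibriumBid (hn : n / 4 ≠ 0) (i : Fin n) {v : ℝ} (hv : v ∈ Icc 0 vbar) :
    interimAlloc F (topQuarterAllPay n) (fun j => equilibriumBid F c j) i
      (equilibriumBid F c i v) = rankInterimAlloc F i v := by
  have hmeas : ∀ j : Fin n, Measurable (equilibriumBid F c j) := fun j =>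
    (monotone_equilibriumBid hc hc' hsupp).measurable
  refine le_antisymm ?_ ?_
  · rw [← winFraction_equilibriumBid hc hc' hsupp hn i hv]
    exact interimAlloc_le_winFraction hmeas _
  · rcases hv.1.eq_or_lt with h0 | h0
    · rw [rankInterimAlloc_of_nonpos hsupp h0.ge]
      exact integral_nonneg fun w => topQuarterAllPay_alloc_nonneg _
    · have hle : ∀ z ∈ Ioo 0 v, rankInterimAlloc F i z ≤ interimAlloc F (topQuarterAllPay n)
          (fun j => equilibriumBid F c j) i (equilibriumBid F c i v) := by
        intro z hz
        have hzI : z ∈ Icc 0 vbar := ⟨hz.1.le, hz.2.le.trans hv.2⟩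
        rw [← winFraction_equilibriumBid hc hc' hsupp hn i hzI]
        refine winFraction_le_interimAlloc hmeas ((equilibriumBid_lt_iff hc hc' hsupp).2 ?_)
        exact strictMonoOn_equilibriumCost hsupp hn hzI hv hz.2
      refine le_on_closure hle continuous_rankInterimAlloc.continuousOn continuousOn_const
        (x := v) ?_
      rw [closure_Ioo h0.ne]
      exact ⟨h0.le, le_rfl⟩

lemma isBayesNash_equilibriumBid :
    IsBayesNash F vbar c (topQuarterAllPay n) (fun i => equilibriumBid F c i) where
  measurable i := (monotone_equilibriumBid hc hc' hsupp).measurable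
  nonneg i v _ := equilibriumBid_nonneg hc' hsupp v
  best_response i v hv b hb := by
    have hmeas : ∀ j : Fin n, Measurable (equilibriumBid F c j) := fun j =>
      (monotone_equilibriumBid hc hc' hsupp).measurable
    have hvb := vbar_pos_of_support hsupp
    have hvI : vbar ∈ Icc 0 vbar := ⟨hvb.le, le_rfl⟩
    have hcb : 0 ≤ c b := by
      have : c b ∈ c '' Ici 0 := mem_image_of_mem c hb
      rwa [hc'] at this
    simp only [interimUtility, interimCost_topQuarterAllPay, cost_equilibriumBid hc' hsupp]
    -- With fewer than four bidders there is no place to win, and the best bid costs nothing.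
    by_cases hn : n / 4 = 0
    · have h0 : ∀ b, interimAlloc F (topQuarterAllPay n) (fun i => equilibriumBid F c i) i b = 0 :=
        fun b => le_antisymm
          ((interimAlloc_le_winFraction hmeas b).trans (winFraction_eq_zero_of_div_eq_zero hn).le)
          (integral_nonneg fun w => topQuarterAllPay_alloc_nonneg _)
      simp only [h0, equilibriumCost, rankInterimAlloc_eq_zero_of_div_eq_zero hn]
      simpa using hcb
    rw [interimAlloc_equilibriumBid hc hc' hsupp hn i hv]
    -- Every deviation is no better than imitating some value z: the one with the same cost if it
    -- exists, otherwise the top value, who wins 4/n for less.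
    have key : ∃ z, interimAlloc F (topQuarterAllPay n) (fun i => equilibriumBid F c i) i b ≤
        rankInterimAlloc F i z ∧ equilibriumCost F i z ≤ c b := by
      rcases le_total (c b) (equilibriumCost F i vbar) with h | h
      · obtain ⟨z, hz, hzb⟩ := intermediate_value_Icc hvb.le
          (continuous_equilibriumCost (F := F) (i := i)).continuousOn
          ⟨equilibriumCost_zero.trans_le hcb, h⟩
        refine ⟨z, ?_, hzb.le⟩
        rw [_root_.eq_equilibriumBid hc hc' hsupp hb hzb.symm,
          interimAlloc_equilibriumBid hc hc' hsupp hn i hz]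
      · refine ⟨vbar, ?_, h⟩
        rw [rankInterimAlloc_vbar hsupp hn]
        exact (interimAlloc_le_winFraction hmeas b).trans winFraction_le
    obtain ⟨z, h1, h2⟩ := key
    have h3 := equilibriumCost_bic (F := F) (i := i) v z
    have h4 := mul_le_mul_of_nonneg_left h1 hv.1
    linarith

end Existence

end Equilibrium

/-! ### Monotone hazard rates: mean against median. -/

section Hazard

variable {F : Measure ℝ} {vbar : ℝ}

lemma continuous_cdf_of_nullSingletonClass (F : Measure ℝ) [IsProbabilityMeasure F]
    [NullSingletonClass F] : Continuous (cdf F) := by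
  refine continuous_iff_continuousAt.2 fun x => ?_
  rw [(monotone_cdf F).continuousAt_iff_leftLim_eq_rightLim, StieltjesFunction.rightLim_eq]
  refine le_antisymm ((monotone_cdf F).leftLim_le le_rfl) ?_
  have h := (cdf F).measure_singleton x
  rw [measure_cdf, measure_singleton] at h
  linarith [ENNReal.ofReal_eq_zero.1 h.symm]

lemma one_sub_cdf_eq (F : Measure ℝ) [IsProbabilityMeasure F] (x : ℝ) :
    1 - cdf F x = F.real (Ioi x) := by
  rw [cdf_eq_real, ← probReal_compl_eq_one_sub measurableSet_Iic, compl_Iic]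

lemma cdf_eq_one_of_le [IsProbabilityMeasure F] (hsupp : F.support = Icc 0 vbar) {x : ℝ}
    (hx : vbar ≤ x) : cdf F x = 1 := by
  have h : Iic x ∈ ae F := by
    filter_upwards [ae_mem_Icc_of_support hsupp] with v hv using hv.2.trans hx
  rw [cdf_eq_real, measureReal_def, (mem_ae_iff_prob_eq_one measurableSet_Iic).1 h,
    ENNReal.toReal_one]

lemma cdf_zero [IsProbabilityMeasure F] [NullSingletonClass F] (hsupp : F.support = Icc 0 vbar) :
    cdf F 0 = 0 := by
  have : F (Iic 0) = 0 := by
    have h0 : ∀ᵐ w ∂F, w ≠ 0 := by rw [ae_iff]; simp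
    refine measure_eq_zero_iff_ae_notMem.2 ?_
    filter_upwards [ae_mem_Icc_of_support hsupp, h0] with v hv hv0 hv'
    exact hv0 (le_antisymm hv' hv.1)
  rw [cdf_eq_real, measureReal_def, this, ENNReal.toReal_zero]

lemma cdf_lt_one [IsProbabilityMeasure F] (hsupp : F.support = Icc 0 vbar) {x : ℝ}
    (hx0 : 0 ≤ x) (hx : x < vbar) : cdf F x < 1 := by
  have h1 := measure_Ioo_pos_of_support hsupp hx0 hx le_rfl
  have h2 : 0 < F.real (Ioi x) :=
    ENNReal.toReal_pos (h1.trans_le (measure_mono Ioo_subset_Ioi_self)).ne' (measure_ne_top _ _)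
  linarith [one_sub_cdf_eq F x]

lemma cdf_eq_integral_density [IsProbabilityMeasure F] {f : ℝ → ℝ}
    (hf : ContinuousOn f (Icc 0 vbar)) (hpos : ∀ v ∈ Icc 0 vbar, 0 < f v)
    (hF : F = (volume.restrict (Icc 0 vbar)).withDensity fun v => ENNReal.ofReal (f v)) {x : ℝ}
    (hx : x ∈ Icc 0 vbar) : cdf F x = ∫ z in (0 : ℝ)..x, f z := by
  have hsub : Icc 0 x ⊆ Icc 0 vbar := Icc_subset_Icc_right hx.2
  have hI : Iic x ∩ Icc 0 vbar = Icc 0 x := by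
    ext z; constructor
    · rintro ⟨h1, h2⟩; exact ⟨h2.1, h1⟩
    · intro h; exact ⟨h.2, hsub h⟩
  have hint : IntegrableOn f (Icc 0 x) := (hf.mono hsub).integrableOn_Icc
  rw [cdf_eq_real, measureReal_def, hF, withDensity_apply _ measurableSet_Iic,
    Measure.restrict_restrict measurableSet_Iic, hI,
    ← ofReal_integral_eq_lintegral_ofReal hint, ENNReal.toReal_ofReal,
    intervalIntegral.integral_of_le hx.1, integral_Icc_eq_integral_Ioc]
  · exact setIntegral_nonneg measurableSet_Icc fun z hz => (hpos z (hsub hz)).le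
  · exact (ae_restrict_iff' measurableSet_Icc).2
      (Filter.Eventually.of_forall fun z hz => (hpos z (hsub hz)).le)

lemma hasDerivAt_cdf [IsProbabilityMeasure F] {f : ℝ → ℝ}
    (hf : ContinuousOn f (Icc 0 vbar)) (hpos : ∀ v ∈ Icc 0 vbar, 0 < f v)
    (hF : F = (volume.restrict (Icc 0 vbar)).withDensity fun v => ENNReal.ofReal (f v)) {x : ℝ}
    (hx : x ∈ Ioo 0 vbar) : HasDerivAt (cdf F) (f x) x := by
  have hnhds : Icc 0 vbar ∈ nhds x := Icc_mem_nhds hx.1 hx.2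
  have h := intervalIntegral.integral_hasDerivAt_right (a := 0) (b := x) (f := f)
    ((hf.mono (by rw [uIcc_of_le hx.1.le]; exact Icc_subset_Icc_right hx.2.le)).intervalIntegrable)
    (hf.stronglyMeasurableAtFilter_nhdsWithin measurableSet_Icc x |>.filter_mono
      (by rw [nhdsWithin_eq_nhds.2 hnhds])) (hf.continuousAt hnhds)
  refine h.congr_of_eventuallyEq ?_
  filter_upwards [hnhds] with y hy using cdf_eq_integral_density hf hpos hF hy

/-- A monotone hazard rate makes the residual value decreasing, so a median halves the survival
probability from every starting point. -/
lemma IsMHR.one_sub_cdf_add_le [IsProbabilityMeasure F] [NullSingletonClass F]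
    (hsupp : F.support = Icc 0 vbar) (h : IsMHR F vbar) {κ : ℝ} (hκ0 : 0 ≤ κ) {z : ℝ}
    (hz : 0 ≤ z) : 1 - cdf F (z + κ) ≤ (1 - cdf F κ) * (1 - cdf F z) := by
  obtain ⟨f, hf, hpos, hF, hmon⟩ := h
  rcases le_or_gt vbar (z + κ) with hzv | hzv
  · rw [cdf_eq_one_of_le hsupp hzv, sub_self]
    exact mul_nonneg (by linarith [cdf_le_one F κ]) (by linarith [cdf_le_one F z])
  have hcont := continuous_cdf_of_nullSingletonClass F
  have hS : ∀ x ∈ Ico 0 (vbar - κ), 0 < 1 - cdf F x := fun x hx => by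
    linarith [cdf_lt_one hsupp hx.1 (show x < vbar by linarith [hx.2])]
  -- The derivative of this survival ratio has the sign of the hazard rate at x minus that at x + κ.
  have hanti : AntitoneOn (fun x => (1 - cdf F (x + κ)) / (1 - cdf F x)) (Ico 0 (vbar - κ)) := by
    have hder : ∀ x ∈ Ioo 0 (vbar - κ), HasDerivAt (fun x => (1 - cdf F (x + κ)) / (1 - cdf F x))
        ((-f (x + κ) * (1 - cdf F x) - (1 - cdf F (x + κ)) * (-f x)) / (1 - cdf F x) ^ 2) x := by
      intro x hx
      have h1 : HasDerivAt (fun x => 1 - cdf F (x + κ)) (-f (x + κ)) x :=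
        ((hasDerivAt_cdf hf hpos hF ⟨by linarith [hx.1], by linarith [hx.2]⟩).comp_add_const
          x κ).const_sub 1
      have h2 : HasDerivAt (fun x => 1 - cdf F x) (-f x) x :=
        (hasDerivAt_cdf hf hpos hF ⟨hx.1, by linarith [hx.2]⟩).const_sub 1
      exact h1.div h2 (hS x ⟨hx.1.le, hx.2⟩).ne'
    refine antitoneOn_of_deriv_nonpos (convex_Ico _ _) ?_ ?_ ?_
    · refine ContinuousOn.div ?_ ?_ fun x hx => (hS x hx).ne'
      · exact (continuous_const.sub
          (hcont.comp (continuous_id.add continuous_const))).continuousOn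
      · exact (continuous_const.sub hcont).continuousOn
    · rw [interior_Ico]
      exact fun x hx => (hder x hx).differentiableAt.differentiableWithinAt
    · rw [interior_Ico]
      intro x hx
      rw [(hder x hx).deriv]
      refine div_nonpos_of_nonpos_of_nonneg ?_ (sq_nonneg _)
      have hx1 : x ∈ Ico 0 vbar := ⟨hx.1.le, by linarith [hx.2]⟩
      have hx2 : x + κ ∈ Ico 0 vbar := ⟨by linarith [hx.1], by linarith [hx.2]⟩
      have hm := hmon hx1 hx2 (by linarith)
      simp only at hm
      rw [div_le_div_iff₀ (hS x ⟨hx.1.le, hx.2⟩) (by linarith [cdf_lt_one hsupp hx2.1 hx2.2])] at hm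
      linarith
  have hvκ : 0 < vbar - κ := by linarith
  have hzm : z ∈ Ico 0 (vbar - κ) := ⟨hz, by linarith⟩
  have := hanti ⟨le_rfl, hvκ⟩ hzm hz
  simp only [zero_add, cdf_zero hsupp, sub_zero, div_one] at this
  rwa [div_le_iff₀ (hS z hzm)] at this

/-- The mean is at most twice the median. -/
lemma IsMHR.lintegral_le [IsProbabilityMeasure F] [NullSingletonClass F]
    (hsupp : F.support = Icc 0 vbar) (h : IsMHR F vbar) {κ : ℝ} (hκ0 : 0 ≤ κ)
    (hκ : cdf F κ = 1 / 2) : ∫⁻ v, ENNReal.ofReal v ∂F ≤ ENNReal.ofReal (2 * κ) := by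
  have hlc : ∫⁻ v, ENNReal.ofReal v ∂F = ∫⁻ t in Ioi (0 : ℝ), F (Ioi t) :=
    lintegral_eq_lintegral_meas_lt F
      (by filter_upwards [ae_mem_Icc_of_support hsupp] with v hv using hv.1) aemeasurable_id
  -- Finiteness is what allows half of the mean to be subtracted at the end.
  have hfin : ∫⁻ v, ENNReal.ofReal v ∂F ≠ ∞ := by
    refine ne_top_of_le_ne_top (b := ENNReal.ofReal vbar) ENNReal.ofReal_ne_top ?_
    calc ∫⁻ v, ENNReal.ofReal v ∂F ≤ ∫⁻ _, ENNReal.ofReal vbar ∂F := by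
          refine lintegral_mono_ae ?_
          filter_upwards [ae_mem_Icc_of_support hsupp] with v hv
          exact ENNReal.ofReal_le_ofReal hv.2
      _ = ENNReal.ofReal vbar := by simp
  set E := ∫⁻ v, ENNReal.ofReal v ∂F with hE
  have hhalf : ∀ t ∈ Ioi (0 : ℝ), F (Ioi (t + κ)) ≤ 2⁻¹ * F (Ioi t) := by
    intro t ht
    have h1 := h.one_sub_cdf_add_le hsupp hκ0 (le_of_lt ht)
    rw [hκ, one_sub_cdf_eq, one_sub_cdf_eq] at h1
    rw [← ofReal_measureReal, ← ofReal_measureReal (s := Ioi t)]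
    refine (ENNReal.ofReal_le_ofReal h1).trans ?_
    rw [ENNReal.ofReal_mul (by norm_num)]
    refine mul_le_mul_left ?_ _
    rw [← ENNReal.ofReal_ofNat, ← ENNReal.ofReal_inv_of_pos (by norm_num)]
    exact ENNReal.ofReal_le_ofReal (by norm_num)
  have hshift : ∫⁻ t in Ioi κ, F (Ioi t) = ∫⁻ t in Ioi (0 : ℝ), F (Ioi (t + κ)) := by
    have hmp : MeasurePreserving (fun t : ℝ => t + κ) volume volume :=
      measurePreserving_add_right volume κ
    have := hmp.setLIntegral_comp_preimage_emb (measurableEmbedding_addRight κ)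
      (fun t => F (Ioi t)) (Ioi κ)
    rw [← this]
    congr 2
    ext t; simp
  -- Split the integrated tail at κ: the first part is at most κ, the shifted rest at most half of
  -- the whole.
  have hle : E ≤ ENNReal.ofReal κ + 2⁻¹ * E := by
    calc E = ∫⁻ t in Ioi (0 : ℝ), F (Ioi t) := hlc
      _ = (∫⁻ t in Ioc 0 κ, F (Ioi t)) + ∫⁻ t in Ioi κ, F (Ioi t) := by
          rw [← lintegral_union measurableSet_Ioi (Ioc_disjoint_Ioi le_rfl), Ioc_union_Ioi_eq_Ioi hκ0]
      _ ≤ ENNReal.ofReal κ + 2⁻¹ * E := by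
          gcongr
          · calc ∫⁻ t in Ioc 0 κ, F (Ioi t) ≤ ∫⁻ _ in Ioc 0 κ, 1 :=
                  lintegral_mono fun t => prob_le_one
              _ = ENNReal.ofReal κ := by simp
          · rw [hshift, hlc, ← lintegral_const_mul' _ _ (by simp)]
            exact setLIntegral_mono' measurableSet_Ioi hhalf
  have hEr : E = ENNReal.ofReal E.toReal := (ENNReal.ofReal_toReal hfin).symm
  have h2 : E.toReal ≤ κ + 2⁻¹ * E.toReal := by
    have := ENNReal.toReal_mono (by finiteness) hle
    rwa [ENNReal.toReal_add (by finiteness) (by finiteness), ENNReal.toReal_mul,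
      ENNReal.toReal_ofReal hκ0, ENNReal.toReal_inv, ENNReal.toReal_ofNat] at this
  rw [hEr]
  exact ENNReal.ofReal_le_ofReal (by linarith)

end Hazard

/-! ### Tail bounds for the number of rivals. -/

section Tails

variable {n : ℕ} {F : Measure ℝ} [IsProbabilityMeasure F] {i : Fin n}

lemma rivalCount_eq_sum [DecidablePred fun j : Fin n => j ≠ i] (A : Set ℝ)
    [DecidablePred fun x => x ∈ A] (w : Fin n → ℝ) :
    rivalCount (fun _ => A) i w = ∑ j with j ≠ i, if w j ∈ A then 1 else 0 := by
  classical
  rw [rivalCount, ncard_eq_toFinset_card', ← Finset.card_filter, Finset.filter_filter]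
  congr 1
  ext j
  simp

lemma card_filter_ne : (Finset.univ.filter fun j : Fin n => j ≠ i).card = n - 1 := by
  rw [Finset.filter_ne', Finset.card_erase_of_mem (Finset.mem_univ _), Finset.card_univ,
    Fintype.card_fin]

lemma measureReal_eval_mem {A : Set ℝ} (hA : MeasurableSet A) (j : Fin n) :
    (valueLaw n F).real {w | w j ∈ A} = F.real A := by
  rw [measureReal_def, measureReal_def]
  congr 1
  exact (measurePreserving_eval (fun _ : Fin n => F) j).measure_preimage hA.nullMeasurableSet

/-- Markov's inequality for the number of rivals in `A`. -/
lemma one_sub_le_measureReal_rivalCount_lt {A : Set ℝ} (hA : MeasurableSet A) {k : ℕ}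
    (hk : 0 < k) :
    1 - (n - 1 : ℕ) * F.real A / k ≤ (valueLaw n F).real {w | rivalCount (fun _ => A) i w < k} := by
  classical
  have hmeas : Measurable fun w : Fin n → ℝ => (rivalCount (fun _ => A) i w : ℝ) :=
    (measurable_from_top (f := fun m : ℕ => (m : ℝ))).comp (measurable_rivalCount fun _ => hA)
  have hind : ∀ j : Fin n, Integrable (fun w : Fin n → ℝ => if w j ∈ A then (1 : ℝ) else 0)
      (valueLaw n F) := by
    intro j
    have : (fun w : Fin n → ℝ => if w j ∈ A then (1 : ℝ) else 0) =
        {w | w j ∈ A}.indicator fun _ => 1 := by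
      ext w; simp [indicator_apply]
    rw [this]
    exact (integrable_const _).indicator (measurable_pi_apply j hA)
  have hsum : (fun w : Fin n → ℝ => (rivalCount (fun _ => A) i w : ℝ)) =
      fun w => ∑ j with j ≠ i, if w j ∈ A then (1 : ℝ) else 0 := by
    ext w; rw [rivalCount_eq_sum]; push_cast; rfl
  have hexp : ∫ w, (rivalCount (fun _ => A) i w : ℝ) ∂(valueLaw n F) = (n - 1 : ℕ) * F.real A := by
    rw [hsum, integral_finsetSum _ fun j _ => hind j]
    have : ∀ j : Fin n, ∫ w : Fin n → ℝ, (if w j ∈ A then (1 : ℝ) else 0) ∂(valueLaw n F) =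
        F.real A := by
      intro j
      have e : (fun w : Fin n → ℝ => if w j ∈ A then (1 : ℝ) else 0) =
          {w | w j ∈ A}.indicator 1 := by
        ext w; simp [indicator_apply]
      have hm : MeasurableSet {w : Fin n → ℝ | w j ∈ A} := measurable_pi_apply j hA
      rw [e, integral_indicator_one hm, measureReal_eval_mem hA]
    rw [Finset.sum_congr rfl fun j _ => this j, Finset.sum_const, card_filter_ne, nsmul_eq_mul]
  have hint : Integrable (fun w : Fin n → ℝ => (rivalCount (fun _ => A) i w : ℝ))
      (valueLaw n F) := by
    rw [hsum]; exact integrable_finsetSum _ fun j _ => hind j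
  have hmarkov := mul_meas_ge_le_integral_of_nonneg (μ := valueLaw n F)
    (Filter.Eventually.of_forall fun w => Nat.cast_nonneg (α := ℝ) (rivalCount (fun _ => A) i w))
    hint (k : ℝ)
  have hcompl : {w : Fin n → ℝ | rivalCount (fun _ => A) i w < k} =
      {w | (k : ℝ) ≤ (rivalCount (fun _ => A) i w : ℝ)}ᶜ := by
    ext w; simp
  rw [hcompl, probReal_compl_eq_one_sub (measurableSet_le measurable_const hmeas)]
  have hk' : (0 : ℝ) < k := by exact_mod_cast hk
  rw [hexp] at hmarkov
  have : (valueLaw n F).real {w | (k : ℝ) ≤ (rivalCount (fun _ => A) i w : ℝ)} ≤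
      (n - 1 : ℕ) * F.real A / k := by
    rw [le_div_iff₀ hk', mul_comm]; exact hmarkov
  linarith

/-- Chernoff's inequality for the number of rivals in a set of probability one half. -/
lemma measureReal_rivalCount_lt_le {A : Set ℝ} (hA : MeasurableSet A) (hF : F.real A = 1 / 2)
    {k : ℕ} (hk : 0 < k) :
    (valueLaw n F).real {w | rivalCount (fun _ => A) i w < k} ≤ 2 ^ (k - 1) * (3 / 4) ^ (n - 1) := by
  classical
  have hg : Integrable (A.indicator (fun _ => (-1 / 2 : ℝ))) F :=
    (integrable_const _).indicator hA
  -- Each rival contributes a factor 1/2 if he is in A and 1 otherwise, so the product is 2^(-N) for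
  -- the count N; each factor has mean 3/4.
  set g : Fin n → ℝ → ℝ := fun j x => if j ≠ i then 1 + A.indicator (fun _ => (-1 / 2 : ℝ)) x else 1
    with hg_def
  have hgint : ∀ j, ∫ x, g j x ∂F = if j ≠ i then 3 / 4 else 1 := by
    intro j
    by_cases hj : j = i
    · simp [hg_def, hj]
    · simp only [hg_def, ne_eq, hj, not_false_eq_true, if_true]
      rw [integral_add (integrable_const _) hg, integral_indicator_const _ hA, hF]
      norm_num
  have hprod : ∀ w : Fin n → ℝ, ∏ j, g j (w j) = (1 / 2) ^ rivalCount (fun _ => A) i w := by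
    intro w
    rw [rivalCount_eq_sum, ← Finset.prod_pow_eq_pow_sum, Finset.prod_filter]
    refine Finset.prod_congr rfl fun j _ => ?_
    by_cases hj : j = i
    · simp [hg_def, hj]
    · by_cases hx : w j ∈ A <;> simp [hg_def, hj, hx]
      norm_num
  have hexp : ∫ w, (1 / 2 : ℝ) ^ rivalCount (fun _ => A) i w ∂(valueLaw n F) =
      (3 / 4) ^ (n - 1) := by
    have e : ∀ w : Fin n → ℝ, (1 / 2 : ℝ) ^ rivalCount (fun _ => A) i w = ∏ j, g j (w j) :=
      fun w => (hprod w).symm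
    simp_rw [e]
    have := integral_fintype_prod_eq_prod (𝕜 := ℝ) (μ := fun _ : Fin n => F) g
    rw [valueLaw, this, Finset.prod_congr rfl fun j _ => hgint j, ← Finset.prod_filter,
      Finset.prod_const, card_filter_ne]
  have hint : Integrable (fun w : Fin n → ℝ => (1 / 2 : ℝ) ^ rivalCount (fun _ => A) i w)
      (valueLaw n F) := by
    refine Integrable.of_bound (C := 1) ?_ (Filter.Eventually.of_forall fun w => ?_)
    · exact ((measurable_from_top (f := fun m : ℕ => (1 / 2 : ℝ) ^ m)).comp
        (measurable_rivalCount fun _ => hA)).aestronglyMeasurable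
    · rw [Real.norm_of_nonneg (by positivity)]
      exact pow_le_one₀ (by norm_num) (by norm_num)
  have hmarkov := mul_meas_ge_le_integral_of_nonneg (μ := valueLaw n F)
    (Filter.Eventually.of_forall fun w => by positivity) hint ((1 / 2 : ℝ) ^ (k - 1))
  -- As k is positive, N < k means N ≤ k - 1, which saves a factor of two.
  have hset : {w : Fin n → ℝ | (1 / 2 : ℝ) ^ (k - 1) ≤ (1 / 2 : ℝ) ^ rivalCount (fun _ => A) i w} =
      {w | rivalCount (fun _ => A) i w < k} := by
    ext w
    rw [mem_ofPred_eq, mem_ofPred_eq, pow_le_pow_iff_right_of_lt_one₀ (by norm_num) (by norm_num)]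
    omega
  rw [hset, hexp] at hmarkov
  calc _ = 2 ^ (k - 1) * ((1 / 2 : ℝ) ^ (k - 1) *
        (valueLaw n F).real {w | rivalCount (fun _ => A) i w < k}) := by
        rw [← mul_assoc, ← mul_pow]; norm_num
    _ ≤ _ := by gcongr

/-- Four more bidders multiply the bound by 2 (3/4)^4 = 81/128 < 1, so the worst case is 2 (3/4)^7 <
7/25. -/
lemma two_pow_mul_three_quarters_pow_le (hn : 8 ≤ n) :
    (2 : ℝ) ^ (n / 4 - 1) * (3 / 4) ^ (n - 1) ≤ 7 / 25 := by
  obtain ⟨k, hk⟩ : ∃ k, n / 4 = k + 2 := ⟨n / 4 - 2, by omega⟩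
  have h1 : 4 * k + 7 ≤ n - 1 := by omega
  rw [hk]
  calc (2 : ℝ) ^ (k + 2 - 1) * (3 / 4) ^ (n - 1) ≤ 2 ^ (k + 1) * (3 / 4) ^ (4 * k + 7) := by
        gcongr 2 ^ ?_ * ?_
        · norm_num
        · omega
        · exact pow_le_pow_of_le_one (by norm_num) (by norm_num) h1
    _ = 2 * (3 / 4) ^ 7 * (81 / 128) ^ k := by
        rw [pow_succ, pow_add, pow_mul, show ((81 : ℝ) / 128) = 2 * (3 / 4) ^ 4 by norm_num, mul_pow]
        ring
    _ ≤ 2 * (3 / 4) ^ 7 * 1 := by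
        gcongr
        exact pow_le_one₀ (by norm_num) (by norm_num)
    _ ≤ 7 / 25 := by norm_num

/-- From the median to the seventh octile the interim allocation gains an eighth of its maximum. -/
lemma le_rankInterimAlloc_sub [NullSingletonClass F] (hn : 88 ≤ n) {κ a : ℝ}
    (hκ : cdf F κ = 1 / 2) (ha : cdf F a = 7 / 8) :
    1 / (2 * n) ≤ rankInterimAlloc F i a - rankInterimAlloc F i κ := by
  have hIci : ∀ x, F.real (Ici x) = 1 - cdf F x := fun x => by
    rw [one_sub_cdf_eq, measureReal_congr Ioi_ae_eq_Ici]
  have hk : 0 < n / 4 := by omega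
  have h1 := one_sub_le_measureReal_rivalCount_lt (F := F) (i := i) (A := Ici a) measurableSet_Ici hk
  have h2 := measureReal_rivalCount_lt_le (F := F) (i := i) (A := Ici κ) measurableSet_Ici
    (by rw [hIci, hκ]; norm_num) hk
  have h3 := two_pow_mul_three_quarters_pow_le (n := n) (by omega)
  rw [hIci, ha] at h1
  have hn0 : (0 : ℝ) < n := by exact_mod_cast (by omega : 0 < n)
  -- Winning has probability at least 9/20 at a and at most 7/25 at κ; the gap 17/100 exceeds 1/8.
  have h4 : ((n - 1 : ℕ) : ℝ) * (1 - 7 / 8) / (n / 4 : ℕ) ≤ 11 / 20 := by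
    rw [div_le_iff₀ (by exact_mod_cast hk)]
    have h5 : ((n - 1 : ℕ) : ℝ) ≤ 4 * (n / 4 : ℕ) + 2 := by exact_mod_cast (by omega)
    have h6 : (22 : ℝ) ≤ (n / 4 : ℕ) := by exact_mod_cast (by omega)
    linarith
  rw [rankInterimAlloc_eq_winFraction, rankInterimAlloc_eq_winFraction, winFraction, winFraction,
    ← mul_sub]
  calc 1 / (2 * (n : ℝ)) = 4 / n * (1 / 8) := by field_simp; norm_num
    _ ≤ _ := by
        gcongr
        linarith

end Tails

/-! ### Bounds on the optimal revenue. -/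

section Optimum

variable {n : ℕ} {F : Measure ℝ} [IsProbabilityMeasure F]

lemma measurable_update_prod (i : Fin n) :
    Measurable fun p : ℝ × (Fin n → ℝ) => Function.update p.2 i p.1 := by
  refine measurable_pi_iff.2 fun j => ?_
  by_cases hj : j = i
  · subst hj; simpa using measurable_fst
  · simpa [Function.update_of_ne hj, Function.comp_def] using
      (measurable_pi_apply j).comp measurable_snd

/-- Redrawing the value of one bidder does not change the law of the profile. -/
lemma measurePreserving_update (i : Fin n) :
    MeasurePreserving (fun p : ℝ × (Fin n → ℝ) => Function.update p.2 i p.1)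
      (F.prod (valueLaw n F)) (valueLaw n F) := by
  refine ⟨measurable_update_prod i, ?_⟩
  refine (Measure.pi_eq fun t ht => ?_).symm
  rw [Measure.map_apply (measurable_update_prod i) (MeasurableSet.univ_pi ht)]
  have : (fun p : ℝ × (Fin n → ℝ) => Function.update p.2 i p.1) ⁻¹' univ.pi t =
      t i ×ˢ univ.pi (Function.update t i univ) := by
    ext ⟨v, w⟩
    simp only [mem_preimage, mem_univ_pi, mem_prod]
    constructor
    · intro h
      refine ⟨by simpa using h i, fun j => ?_⟩
      by_cases hj : j = i
      · subst hj; simp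
      · simpa [hj] using h j
    · rintro ⟨h1, h2⟩ j
      by_cases hj : j = i
      · subst hj; simpa using h1
      · simpa [hj] using h2 j
  rw [this, Measure.prod_prod, valueLaw, Measure.pi_pi, ← Finset.mul_prod_erase _ _
    (Finset.mem_univ i), ← Finset.mul_prod_erase _ (fun j => F (t j)) (Finset.mem_univ i)]
  simp only [Function.update_self, measure_univ, one_mul]
  congr 1
  refine Finset.prod_congr rfl fun j hj => ?_
  rw [Function.update_of_ne (Finset.ne_of_mem_erase hj)]

/-- This passes from expected to interim quantities in the form of `bidsAgainst`, where the own
coordinate is overwritten rather than removed. -/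
lemma lintegral_eq_lintegral_update (i : Fin n) {g : (Fin n → ℝ) → ℝ≥0∞} (hg : Measurable g) :
    ∫⁻ w, g w ∂(valueLaw n F) =
      ∫⁻ v, ∫⁻ w, g (Function.update w i v) ∂(valueLaw n F) ∂F := by
  rw [← (measurePreserving_update i).lintegral_comp hg]
  exact lintegral_prod _ (hg.comp (measurable_update_prod i)).aemeasurable

variable {vbar : ℝ} (hsupp : F.support = Icc 0 vbar)

include hsupp in
lemma ae_forall_mem_Icc : ∀ᵐ w ∂(valueLaw n F), ∀ j, w j ∈ Icc 0 vbar :=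
  ae_all_iff.2 fun j => (Measure.tendsto_eval_ae_ae (μ := fun _ : Fin n => F) (i := j)).eventually
    (ae_mem_Icc_of_support hsupp)

/-- Under a power cost, the mean payment is bounded by the inverse cost of the mean cost. -/
lemma lintegral_ofReal_le_rpow_integral {Ω : Type*} [MeasurableSpace Ω] {μ : Measure Ω}
    [IsProbabilityMeasure μ] {p : Ω → ℝ} {d : ℝ} (hd : 1 ≤ d) (hp : AEStronglyMeasurable p μ)
    (h0 : 0 ≤ᵐ[μ] p) (hint : Integrable (fun x => p x ^ d) μ) :
    ∫⁻ x, ENNReal.ofReal (p x) ∂μ ≤ ENNReal.ofReal ((∫ x, p x ^ d ∂μ) ^ (1 / d)) := by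
  have hd0 : 0 < d := by linarith
  -- Jensen's inequality, as monotonicity of L^p norms on a probability space.
  have h1 : eLpNorm p 1 μ ≤ eLpNorm p (ENNReal.ofReal d) μ :=
    eLpNorm_le_eLpNorm_of_exponent_le (by simpa using hd) hp
  rw [eLpNorm_one_eq_lintegral_enorm, eLpNorm_eq_lintegral_rpow_enorm_toReal (by simpa using hd0)
    ENNReal.ofReal_ne_top, ENNReal.toReal_ofReal hd0.le] at h1
  have e1 : ∫⁻ x, ‖p x‖ₑ ∂μ = ∫⁻ x, ENNReal.ofReal (p x) ∂μ := by
    refine lintegral_congr_ae ?_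
    filter_upwards [h0] with x hx using Real.enorm_of_nonneg hx
  have e2 : ∫⁻ x, ‖p x‖ₑ ^ d ∂μ = ENNReal.ofReal (∫ x, p x ^ d ∂μ) := by
    rw [ofReal_integral_eq_lintegral_ofReal hint
      (by filter_upwards [h0] with x hx using Real.rpow_nonneg hx d)]
    refine lintegral_congr_ae ?_
    filter_upwards [h0] with x hx
    rw [Real.enorm_of_nonneg hx, ENNReal.ofReal_rpow_of_nonneg hx hd0.le]
  rw [e1, e2, ENNReal.ofReal_rpow_of_nonneg _ (by positivity)] at h1
  · exact h1
  · exact integral_nonneg_of_ae (by filter_upwards [h0] with x hx using Real.rpow_nonneg hx d)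

/-- The arithmetic-geometric inequality behind the bound on the optimal revenue. -/
lemma mul_rpow_le {d m N v x : ℝ} (hd : 2 ≤ d) (hm : 0 < m) (hN : 0 < N) (hv : 0 ≤ v)
    (hx : 0 ≤ x) :
    (v * x) ^ (1 / d) ≤ (m / N) ^ (1 / d) * (1 / (d * m) * v + (1 - 2 / d) + N / d * x) := by
  have hd0 : 0 < d := by linarith
  -- The third weight 1 - 2/d is where d ≥ 2 enters. The three terms agree at v = m and x = 1/N, so
  -- the bound is tight at the average value and an equal share.
  have h := Real.geom_mean_le_arith_mean3_weighted (w₁ := 1 / d) (w₂ := 1 / d) (w₃ := 1 - 2 / d)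
    (p₁ := v / m) (p₂ := N * x) (p₃ := 1) (by positivity) (by positivity)
    (by rw [sub_nonneg, div_le_one hd0]; exact hd) (by positivity) (by positivity) zero_le_one
    (by ring)
  rw [Real.one_rpow, mul_one, mul_one, ← Real.mul_rpow (by positivity) (by positivity)] at h
  have e : v * x = (m / N) * (v / m * (N * x)) := by field_simp
  rw [e, Real.mul_rpow (by positivity) (by positivity)]
  refine mul_le_mul_of_nonneg_left (h.trans_eq ?_) (by positivity)
  field_simp
  ring

section Admissible

variable {d m : ℝ} {M : Mechanism n} (hM : IsAdmissible F vbar (fun p => p ^ d) M)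
include hM hsupp

/-- Given his value v, the mean payment of bidder i is at most (v x̂(v))^(1/d). The linear bound in
v and x̂(v) separates the two, so no information on their dependence is needed. -/
lemma IsAdmissible.lintegral_pay_le (hd : 2 ≤ d) (hm : 0 < m)
    (hmean : ∫⁻ v, ENNReal.ofReal v ∂F ≤ ENNReal.ofReal m) (i : Fin n) :
    ∫⁻ w, ENNReal.ofReal (M.pay w i) ∂(valueLaw n F) ≤
      ENNReal.ofReal ((m / n) ^ (1 / d)) * (ENNReal.ofReal (1 - 1 / d) +
        ENNReal.ofReal (n / d) * ∫⁻ w, ENNReal.ofReal (M.alloc w i) ∂(valueLaw n F)) := by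
  have hn : (0 : ℝ) < n := by exact_mod_cast i.pos
  have hd0 : 0 < d := by linarith
  have hall := ae_forall_mem_Icc (n := n) hsupp
  have hupd : ∀ {v : ℝ}, v ∈ Icc 0 vbar → ∀ {w : Fin n → ℝ}, (∀ j, w j ∈ Icc 0 vbar) →
      ∀ j, Function.update w i v j ∈ Icc 0 vbar := by
    intro v hv w hw j
    by_cases hj : j = i
    · subst hj; simpa using hv
    · simpa [hj] using hw j
  have hmu : ∀ v : ℝ, Measurable fun w : Fin n → ℝ => Function.update w i v := fun v =>
    (measurable_update_prod i).comp (measurable_const.prodMk measurable_id)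
  rw [lintegral_eq_lintegral_update i (hM.measurable_pay i).ennreal_ofReal,
    lintegral_eq_lintegral_update i (hM.measurable_alloc i).ennreal_ofReal]
  have hpt : ∀ v ∈ Icc 0 vbar,
      ∫⁻ w, ENNReal.ofReal (M.pay (Function.update w i v) i) ∂(valueLaw n F) ≤
        ENNReal.ofReal ((m / n) ^ (1 / d)) * ((ENNReal.ofReal (1 / (d * m)) * ENNReal.ofReal v +
          ENNReal.ofReal (1 - 2 / d)) + ENNReal.ofReal (n / d) *
          ∫⁻ w, ENNReal.ofReal (M.alloc (Function.update w i v) i) ∂(valueLaw n F)) := by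
    intro v hv
    have hX0 : 0 ≤ᵐ[valueLaw n F] fun w => M.alloc (Function.update w i v) i := by
      filter_upwards [hall] with w hw using (hM.alloc_mem _ (hupd hv hw) i).1
    have hXint : Integrable (fun w => M.alloc (Function.update w i v) i) (valueLaw n F) := by
      refine Integrable.of_bound (C := 1)
        ((hM.measurable_alloc i).comp (hmu v)).aestronglyMeasurable ?_
      filter_upwards [hall] with w hw
      have := hM.alloc_mem _ (hupd hv hw) i
      rw [Real.norm_of_nonneg this.1]
      exact this.2
    set X := ∫ w, M.alloc (Function.update w i v) i ∂(valueLaw n F) with hX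
    have hXnn : 0 ≤ X := integral_nonneg_of_ae hX0
    have hC : ∫ w, M.pay (Function.update w i v) i ^ d ∂(valueLaw n F) ≤ v * X :=
      sub_nonneg.1 (hM.iir i v hv)
    have hp0 : 0 ≤ᵐ[valueLaw n F] fun w => M.pay (Function.update w i v) i := by
      filter_upwards [hall] with w hw using hM.pay_nonneg _ (hupd hv hw) i
    have hCnn : 0 ≤ ∫ w, M.pay (Function.update w i v) i ^ d ∂(valueLaw n F) :=
      integral_nonneg_of_ae (by filter_upwards [hp0] with x hx using Real.rpow_nonneg hx d)
    refine (lintegral_ofReal_le_rpow_integral (by linarith)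
      ((hM.measurable_pay i).comp (hmu v)).aestronglyMeasurable hp0
      (hM.integrable_cost i v hv)).trans ?_
    rw [← ofReal_integral_eq_lintegral_ofReal hXint hX0, ← hX,
      ← ENNReal.ofReal_mul (by positivity), ← ENNReal.ofReal_mul (by positivity),
      ← ENNReal.ofReal_add (mul_nonneg (by positivity) hv.1)
        (by rw [sub_nonneg, div_le_one hd0]; exact hd),
      ← ENNReal.ofReal_add (add_nonneg (mul_nonneg (by positivity) hv.1)
        (by rw [sub_nonneg, div_le_one hd0]; exact hd)) (by positivity),
      ← ENNReal.ofReal_mul (by positivity)]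
    refine ENNReal.ofReal_le_ofReal ((Real.rpow_le_rpow hCnn hC (by positivity)).trans ?_)
    exact mul_rpow_le hd hm hn hv.1 hXnn
  calc _ ≤ ∫⁻ v, ENNReal.ofReal ((m / n) ^ (1 / d)) * ((ENNReal.ofReal (1 / (d * m)) *
          ENNReal.ofReal v + ENNReal.ofReal (1 - 2 / d)) + ENNReal.ofReal (n / d) *
          ∫⁻ w, ENNReal.ofReal (M.alloc (Function.update w i v) i) ∂(valueLaw n F)) ∂F := by
        refine lintegral_mono_ae ?_
        filter_upwards [ae_mem_Icc_of_support hsupp] with v hv using hpt v hv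
    _ = ENNReal.ofReal ((m / n) ^ (1 / d)) * ((ENNReal.ofReal (1 / (d * m)) *
          ∫⁻ v, ENNReal.ofReal v ∂F + ENNReal.ofReal (1 - 2 / d)) + ENNReal.ofReal (n / d) *
          ∫⁻ v, ∫⁻ w, ENNReal.ofReal (M.alloc (Function.update w i v) i) ∂(valueLaw n F) ∂F) := by
        rw [lintegral_const_mul' _ _ ENNReal.ofReal_ne_top,
          lintegral_add_left (by fun_prop), lintegral_const_mul' _ _ ENNReal.ofReal_ne_top,
          lintegral_add_left (by fun_prop), lintegral_const_mul' _ _ ENNReal.ofReal_ne_top,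
          lintegral_const, measure_univ, mul_one]
    _ ≤ _ := by
        gcongr
        calc _ ≤ ENNReal.ofReal (1 / (d * m)) * ENNReal.ofReal m + ENNReal.ofReal (1 - 2 / d) := by
              gcongr
          _ = ENNReal.ofReal (1 - 1 / d) := by
              rw [← ENNReal.ofReal_mul (by positivity), ← ENNReal.ofReal_add (by positivity)
                (by rw [sub_nonneg, div_le_one hd0]; exact hd)]
              congr 1
              field_simp
              ring

/-- Summing over bidders, feasibility bounds the total allocation by 1, and the remaining
coefficients 1 - 1/d and 1/d add up to 1. -/
lemma IsAdmissible.revenue_le (hd : 2 ≤ d) (hm : 0 < m) (hn : 0 < n)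
    (hmean : ∫⁻ v, ENNReal.ofReal v ∂F ≤ ENNReal.ofReal m) :
    revenue F M (truthful n) ≤ ENNReal.ofReal (n * (m / n) ^ (1 / d)) := by
  have hn' : (0 : ℝ) < n := by exact_mod_cast hn
  have hd0 : 0 < d := by linarith
  have hxp : ∑ i, ∫⁻ w, ENNReal.ofReal (M.alloc w i) ∂(valueLaw n F) ≤ 1 := by
    rw [← lintegral_finsetSum _ fun i _ => (hM.measurable_alloc i).ennreal_ofReal]
    calc _ ≤ ∫⁻ _, 1 ∂(valueLaw n F) := by
          refine lintegral_mono_ae ?_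
          filter_upwards [ae_forall_mem_Icc (n := n) hsupp] with w hw
          rw [← ENNReal.ofReal_sum_of_nonneg fun i _ => (hM.alloc_mem w hw i).1]
          exact ENNReal.ofReal_le_one.2 (hM.xp w hw)
      _ = 1 := by simp
  calc revenue F M (truthful n) = ∑ i, ∫⁻ w, ENNReal.ofReal (M.pay w i) ∂(valueLaw n F) :=
        lintegral_finsetSum _ fun i _ => (hM.measurable_pay i).ennreal_ofReal
    _ ≤ ∑ i, ENNReal.ofReal ((m / n) ^ (1 / d)) * (ENNReal.ofReal (1 - 1 / d) +
          ENNReal.ofReal (n / d) * ∫⁻ w, ENNReal.ofReal (M.alloc w i) ∂(valueLaw n F)) :=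
        Finset.sum_le_sum fun i _ => hM.lintegral_pay_le hsupp hd hm hmean i
    _ = ENNReal.ofReal ((m / n) ^ (1 / d)) * (n * ENNReal.ofReal (1 - 1 / d) +
          ENNReal.ofReal (n / d) * ∑ i, ∫⁻ w, ENNReal.ofReal (M.alloc w i) ∂(valueLaw n F)) := by
        rw [← Finset.mul_sum, Finset.sum_add_distrib, ← Finset.mul_sum]
        simp
    _ ≤ ENNReal.ofReal ((m / n) ^ (1 / d)) * (n * ENNReal.ofReal (1 - 1 / d) +
          ENNReal.ofReal (n / d) * 1) := by gcongr
    _ = ENNReal.ofReal (n * (m / n) ^ (1 / d)) := by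
        have h1 : 0 ≤ 1 - 1 / d := by rw [sub_nonneg, div_le_one hd0]; linarith
        rw [mul_one, ← ENNReal.ofReal_natCast, ← ENNReal.ofReal_mul (by positivity),
          ← ENNReal.ofReal_add (by positivity) (by positivity),
          ← ENNReal.ofReal_mul (by positivity)]
        congr 1
        field_simp
        ring

end Admissible

/-- The mechanism that sells `1 / n` to every bidder at a posted price of cost `κ / n`. -/
noncomputable def postedPrice (n : ℕ) (κ d : ℝ) : Mechanism n where
  alloc w i := if κ ≤ w i then 1 / n else 0
  pay w i := if κ ≤ w i then (κ / n) ^ (1 / d) else 0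

/-- Buying leaves utility (v - κ)/n, so a bidder wants to buy exactly when the mechanism sells to
him. This mechanism serves as witness that OPT is positive. -/
lemma isAdmissible_postedPrice {κ d : ℝ} (hκ : 0 ≤ κ) (hd : 0 < d) :
    IsAdmissible F vbar (fun p => p ^ d) (postedPrice n κ d) := by
  have hcost : ∀ (i : Fin n) (v : ℝ) (w : Fin n → ℝ),
      ((postedPrice n κ d).pay (bidsAgainst (truthful n) i v w) i) ^ d =
        if κ ≤ v then κ / n else 0 := by
    intro i v w
    simp only [postedPrice, bidsAgainst, Function.update_self]
    split_ifs
    · rw [← Real.rpow_mul (by positivity), one_div_mul_cancel hd.ne', Real.rpow_one]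
    · exact Real.zero_rpow hd.ne'
  have halloc : ∀ (i : Fin n) (v : ℝ) (w : Fin n → ℝ),
      (postedPrice n κ d).alloc (bidsAgainst (truthful n) i v w) i =
        if κ ≤ v then 1 / (n : ℝ) else 0 := by
    intro i v w
    simp only [postedPrice, bidsAgainst, Function.update_self]
  have hutil : ∀ (i : Fin n) (v b : ℝ),
      interimUtility F (fun p => p ^ d) (postedPrice n κ d) (truthful n) i v b =
        if κ ≤ b then (v - κ) / n else 0 := by
    intro i v b
    simp only [interimUtility, interimAlloc, interimCost, hcost, halloc, integral_const,
      probReal_univ, one_smul]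
    split_ifs <;> ring
  have hmeas : ∀ (i : Fin n) (a : ℝ), Measurable fun w : Fin n → ℝ => if κ ≤ w i then a else 0 :=
    fun i a => Measurable.ite (measurableSet_le measurable_const (measurable_pi_apply i))
      measurable_const measurable_const
  refine ⟨fun i => hmeas i _, fun i => hmeas i _, ?_, ?_, ?_, ?_, ?_, ?_⟩
  · intro v _ i
    have hn : 1 ≤ (n : ℝ) := by exact_mod_cast i.pos
    simp only [postedPrice]
    split_ifs
    · exact ⟨by positivity, by rw [div_le_one (by linarith)]; exact hn⟩
    · exact ⟨le_rfl, zero_le_one⟩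
  · intro v _ i
    simp only [postedPrice]
    split_ifs
    · positivity
    · exact le_rfl
  · intro v _
    calc ∑ i, (postedPrice n κ d).alloc v i ≤ ∑ _i : Fin n, 1 / (n : ℝ) := by
          refine Finset.sum_le_sum fun i _ => ?_
          simp only [postedPrice]
          split_ifs
          · exact le_rfl
          · positivity
      _ ≤ 1 := by
          rw [Finset.sum_const, Finset.card_univ, Fintype.card_fin, nsmul_eq_mul, mul_one_div]
          exact div_self_le_one _
  · intro i v _
    simp only [hcost]
    exact integrable_const _
  · intro i v _ v' _
    rw [hutil, hutil]
    split_ifs with h1 h2 h2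
    · exact le_rfl
    · exact div_nonpos_of_nonpos_of_nonneg (by linarith) (by positivity)
    · exact div_nonneg (by linarith) (by positivity)
    · exact le_rfl
  · intro i v _
    rw [hutil]
    split_ifs with h1
    · exact div_nonneg (by linarith) (by positivity)
    · exact le_rfl

lemma lintegral_ofReal_ge_of_eval (i : Fin n) {g : ℝ → ℝ} (hg : Measurable g) {A : Set ℝ}
    (hA : MeasurableSet A) {b : ℝ} (hb : ∀ v ∈ A, b ≤ g v) :
    ENNReal.ofReal b * F A ≤ ∫⁻ w, ENNReal.ofReal (g (w i)) ∂(valueLaw n F) := by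
  rw [valueLaw, (measurePreserving_eval (fun _ : Fin n => F) i).lintegral_comp
    (f := fun v => ENNReal.ofReal (g v)) hg.ennreal_ofReal, ← setLIntegral_const]
  exact (setLIntegral_mono' hA fun v hv => ENNReal.ofReal_le_ofReal (hb v hv)).trans
    (setLIntegral_le_lintegral _ _)

lemma revenue_postedPrice_pos (hn : 0 < n) {κ d : ℝ} (hκ : 0 < κ) (hF : F (Ici κ) ≠ 0) :
    0 < revenue F (postedPrice n κ d) (truthful n) := by
  have hn' : (0 : ℝ) < n := by exact_mod_cast hn
  have h := lintegral_ofReal_ge_of_eval (F := F) (⟨0, hn⟩ : Fin n)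
    (g := fun v => if κ ≤ v then (κ / n) ^ (1 / d) else 0)
    (Measurable.ite measurableSet_Ici measurable_const measurable_const)
    (A := Ici κ) measurableSet_Ici (b := (κ / n) ^ (1 / d))
    (fun v hv => by simp only [mem_Ici] at hv; simp [hv])
  refine lt_of_lt_of_le ?_ (h.trans (lintegral_mono fun w => ?_))
  · exact ENNReal.mul_pos (ENNReal.ofReal_pos.2 (by positivity)).ne' hF
  · exact Finset.single_le_sum
      (f := fun i => ENNReal.ofReal ((postedPrice n κ d).pay (fun j => truthful n j (w j)) i))
      (fun i _ => zero_le) (Finset.mem_univ (⟨0, hn⟩ : Fin n))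

end Optimum

/-! ### Equilibrium revenue and the approximation ratio. -/

section Revenue

variable {n : ℕ} {F : Measure ℝ} [IsProbabilityMeasure F] [NullSingletonClass F] {vbar : ℝ}

lemma strictMonoOn_rpow_Ici {d : ℝ} (hd : 0 < d) :
    StrictMonoOn (fun p : ℝ => p ^ d) (Ici 0) := fun _ hx _ _ hxy => Real.rpow_lt_rpow hx hxy hd

lemma image_rpow_Ici {d : ℝ} (hd : 0 < d) : (fun p : ℝ => p ^ d) '' Ici 0 = Ici 0 := by
  ext y
  constructor
  · rintro ⟨x, hx, rfl⟩
    exact Real.rpow_nonneg hx d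
  · intro hy
    refine ⟨y ^ (1 / d), Real.rpow_nonneg hy _, ?_⟩
    simp only
    rw [← Real.rpow_mul hy, one_div_mul_cancel hd.ne', Real.rpow_one]

/-- Since κ ≤ v̄, the logarithm is at least log 16 = 4 log 2, and 128 log 2 > 88. -/
lemma eighty_eight_le {κ : ℝ} (hκ : 0 < κ) (hκv : κ ≤ vbar)
    (hn : 32 * Real.log (16 * vbar / κ) ≤ n) : 88 ≤ n := by
  have h1 : Real.log 16 ≤ Real.log (16 * vbar / κ) := by
    refine Real.log_le_log (by norm_num) ?_
    rw [le_div_iff₀ hκ]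
    linarith
  have h2 : Real.log 16 = 4 * Real.log 2 := by
    rw [show (16 : ℝ) = 2 ^ 4 by norm_num, Real.log_pow]; norm_num
  have h3 := Real.log_two_gt_d9
  have : (88 : ℝ) ≤ n := by linarith
  exact_mod_cast this

lemma median_mem_Ioo (hsupp : F.support = Icc 0 vbar) {κ : ℝ} (hκ : cdf F κ = 1 / 2) :
    κ ∈ Ioo 0 vbar := by
  constructor
  · by_contra! h
    have := monotone_cdf F h
    rw [hκ, cdf_zero hsupp] at this
    norm_num at this
  · by_contra! h
    rw [cdf_eq_one_of_le hsupp h] at hκ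
    norm_num at hκ

/-- Every value above the 7/8 quantile, hence each bidder with probability 1/8, bids at least
(κ/(2n))^(1/d): otherwise the median value would gain by imitating the quantile. -/
lemma le_revenue_equilibriumBid (hsupp : F.support = Icc 0 vbar) {d κ : ℝ} (hd : 0 < d)
    (hn : 88 ≤ n) (hκ : cdf F κ = 1 / 2) {s : Fin n → ℝ → ℝ} (hs : ∀ i, Measurable (s i))
    (hseq : ∀ i, ∀ v ∈ Icc 0 vbar, s i v = equilibriumBid F (fun p => p ^ d) i v) :
    ENNReal.ofReal (n * (κ / (2 * n)) ^ (1 / d) / 8) ≤ revenue F (topQuarterAllPay n) s := by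
  have hκI := median_mem_Ioo hsupp hκ
  have hvb := vbar_pos_of_support hsupp
  have hc := strictMonoOn_rpow_Ici hd
  have hc' := image_rpow_Ici hd
  obtain ⟨a, haI, ha⟩ : ∃ a ∈ Icc 0 vbar, cdf F a = 7 / 8 :=
    intermediate_value_Icc hvb.le (continuous_cdf_of_nullSingletonClass F).continuousOn
      (by rw [cdf_zero hsupp, cdf_eq_one_of_le hsupp le_rfl]; constructor <;> norm_num)
  have hFa : F (Icc a vbar) = ENNReal.ofReal (1 / 8) := by
    have h1 : F (Icc a vbar) = F (Ici a) := by
      refine measure_congr ?_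
      filter_upwards [ae_mem_Icc_of_support hsupp] with v hv
      exact propext ⟨fun h => h.1, fun h => ⟨h, hv.2⟩⟩
    rw [h1, ← measure_congr Ioi_ae_eq_Ici, ← ofReal_measureReal, ← one_sub_cdf_eq, ha]
    norm_num
  set b := (κ / (2 * n)) ^ (1 / d) with hb
  have hn' : (0 : ℝ) < n := by exact_mod_cast (by omega : 0 < n)
  have hbid : ∀ (i : Fin n), ∀ v ∈ Icc a vbar, b ≤ s i v := by
    intro i v hv
    have hvI : v ∈ Icc 0 vbar := ⟨haI.1.trans hv.1, hv.2⟩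
    rw [hseq i v hvI]
    refine le_trans ?_ (monotone_equilibriumBid hc hc' hsupp hv.1)
    have h1 := mul_sub_le_equilibriumCost_sub (F := F) (i := i) κ a
    have h2 := le_rankInterimAlloc_sub (i := i) hn hκ ha
    have h3 := equilibriumCost_nonneg (F := F) (i := i) hsupp κ
    have h4 := mul_le_mul_of_nonneg_left h2 hκI.1.le
    have h5 : κ / (2 * n) ≤ equilibriumBid F (fun p => p ^ d) i a ^ d := by
      have := cost_equilibriumBid (i := i) hc' hsupp a
      rw [this, div_eq_mul_one_div]
      linarith
    have hκ0 : 0 ≤ κ := hκI.1.le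
    have h6 := Real.rpow_le_rpow (by positivity) h5 (by positivity : 0 ≤ 1 / d)
    rwa [← Real.rpow_mul (equilibriumBid_nonneg hc' hsupp a), mul_one_div_cancel hd.ne',
      Real.rpow_one] at h6
  have hmeas : ∀ i : Fin n, Measurable fun w : Fin n → ℝ => ENNReal.ofReal (s i (w i)) := fun i =>
    ((hs i).comp (measurable_pi_apply i)).ennreal_ofReal
  calc ENNReal.ofReal (n * b / 8) = ∑ _i : Fin n, ENNReal.ofReal b * F (Icc a vbar) := by
        have hb0 : 0 ≤ b := Real.rpow_nonneg (div_nonneg hκI.1.le (by positivity)) _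
        rw [hFa, Finset.sum_const, Finset.card_univ, Fintype.card_fin, nsmul_eq_mul,
          ← ENNReal.ofReal_natCast, ← ENNReal.ofReal_mul hb0, ← ENNReal.ofReal_mul hn'.le]
        congr 1
        ring
    _ ≤ ∑ i, ∫⁻ w, ENNReal.ofReal (s i (w i)) ∂(valueLaw n F) :=
        Finset.sum_le_sum fun i _ =>
          lintegral_ofReal_ge_of_eval i (hs i) measurableSet_Icc (hbid i)
    _ = revenue F (topQuarterAllPay n) s := (lintegral_finsetSum _ fun i _ => hmeas i).symm

lemma optRevenue_le (hsupp : F.support = Icc 0 vbar) {d κ : ℝ} (hd : 2 ≤ d) (hn : 0 < n)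
    (hF : IsMHR F vbar) (hκ : cdf F κ = 1 / 2) :
    optRevenue n F vbar (fun p => p ^ d) ≤ ENNReal.ofReal (n * (2 * κ / n) ^ (1 / d)) := by
  have hκI := median_mem_Ioo hsupp hκ
  exact iSup₂_le fun M hM => hM.revenue_le hsupp hd (by linarith [hκI.1]) hn
    (hF.lintegral_le hsupp hκI.1.le hκ)

lemma optRevenue_ne_zero (hsupp : F.support = Icc 0 vbar) {d κ : ℝ} (hd : 0 < d) (hn : 0 < n)
    (hκ : cdf F κ = 1 / 2) : optRevenue n F vbar (fun p => p ^ d) ≠ 0 := by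
  have hκI := median_mem_Ioo hsupp hκ
  have hF : F (Ici κ) ≠ 0 := ((measure_Ioo_pos_of_support hsupp hκI.1.le hκI.2 le_rfl).trans_le
    (measure_mono fun v hv => hv.1.le)).ne'
  refine ((revenue_postedPrice_pos hn hκI.1 hF (d := d)).trans_le ?_).ne'
  exact le_iSup₂ (f := fun M (_ : IsAdmissible F vbar (fun p => p ^ d) M) =>
    revenue F M (truthful n)) (postedPrice n κ d) (isAdmissible_postedPrice hκI.1.le hd)

/-- The two revenue bounds differ by a factor 4 under the root, which costs 4^(1/d) ≤ 2 for d ≥ 2,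
besides the factor 1/8. -/
lemma rpow_two_mul_div_le {κ d : ℝ} (hκ : 0 ≤ κ) (hd : 2 ≤ d) (hn : 0 < n) :
    1 / 16 * (n * (2 * κ / n) ^ (1 / d)) ≤ n * (κ / (2 * n)) ^ (1 / d) / 8 := by
  have hn' : (0 : ℝ) < n := by exact_mod_cast hn
  have e : 2 * κ / n = 4 * (κ / (2 * n)) := by field_simp; ring
  have h4 : (4 : ℝ) ^ (1 / d) ≤ 2 := by
    calc (4 : ℝ) ^ (1 / d) ≤ 4 ^ (1 / 2 : ℝ) :=
          Real.rpow_le_rpow_of_exponent_le (by norm_num)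
            (one_div_le_one_div_of_le (by norm_num) hd)
      _ = 2 := by
          rw [← Real.sqrt_eq_rpow, show (4 : ℝ) = 2 ^ 2 by norm_num]
          exact Real.sqrt_sq (by norm_num)
  rw [e, Real.mul_rpow (by norm_num) (by positivity)]
  have hb : 0 ≤ n * (κ / (2 * n)) ^ (1 / d) := by positivity
  nlinarith

end Revenue

theorem mainTheorem4 (n : ℕ) (F : Measure ℝ) [IsProbabilityMeasure F] [NullSingletonClass F]
    (vbar : ℝ) (hsupp : F.support = Icc 0 vbar) :
    (∀ c : ℝ → ℝ, StrictMonoOn c (Ici 0) → c '' Ici 0 = Ici 0 →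
      IsBayesNash F vbar c (topQuarterAllPay n) (fun i => equilibriumBid F c i) ∧
      ∀ s : Fin n → ℝ → ℝ, IsBayesNash F vbar c (topQuarterAllPay n) s →
        ∀ i, ∀ v ∈ Icc 0 vbar, s i v = equilibriumBid F c i v) ∧
    (∀ d κ : ℝ, 2 ≤ d → IsMHR F vbar → cdf F κ = 1 / 2 →
      32 * Real.log (16 * vbar / κ) ≤ n →
      ∀ s : Fin n → ℝ → ℝ, IsBayesNash F vbar (fun p => p ^ d) (topQuarterAllPay n) s →
        optRevenue n F vbar (fun p => p ^ d) ≠ 0 ∧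
        optRevenue n F vbar (fun p => p ^ d) ≠ ∞ ∧
        1 / 16 ≤ revenue F (topQuarterAllPay n) s /
          optRevenue n F vbar (fun p => p ^ d)) := by
  refine ⟨fun c hc hc' => ⟨isBayesNash_equilibriumBid hc hc' hsupp, fun s hs i v hv =>
    hs.eq_equilibriumBid hc hc' hsupp i hv⟩, fun d κ hd hF hκ hlog s hs => ?_⟩
  have hd0 : 0 < d := by linarith
  have hκI := median_mem_Ioo hsupp hκ
  have hn := eighty_eight_le hκI.1 hκI.2.le hlog
  have hn0 : 0 < n := by omega
  have hle := optRevenue_le (n := n) hsupp hd hn0 hF hκ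
  have h0 := optRevenue_ne_zero (n := n) hsupp hd0 hn0 hκ
  have htop := ne_top_of_le_ne_top ENNReal.ofReal_ne_top hle
  refine ⟨h0, htop, ?_⟩
  rw [ENNReal.le_div_iff_mul_le (Or.inl h0) (Or.inl htop)]
  calc 1 / 16 * optRevenue n F vbar (fun p => p ^ d)
      ≤ ENNReal.ofReal (1 / 16) * ENNReal.ofReal (n * (2 * κ / n) ^ (1 / d)) := by
        gcongr
        rw [ENNReal.ofReal_div_of_pos (by norm_num)]
        simp
    _ = ENNReal.ofReal (1 / 16 * (n * (2 * κ / n) ^ (1 / d))) :=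
        (ENNReal.ofReal_mul (by norm_num)).symm
    _ ≤ ENNReal.ofReal (n * (κ / (2 * n)) ^ (1 / d) / 8) :=
        ENNReal.ofReal_le_ofReal (rpow_two_mul_div_le hκI.1.le hd hn0)
    _ ≤ revenue F (topQuarterAllPay n) s :=
        le_revenue_equilibriumBid hsupp hd0 hn hκ hs.measurable fun i v hv =>
          hs.eq_equilibriumBid (strictMonoOn_rpow_Ici hd0) (image_rpow_Ici hd0) hsupp i hv
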